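/- **Model.** There are $k$ players and a coordinator. Each player $j$ receives a private set $E_j$ of edges on the vertex set $[n]$; the sets need not be disjoint. The input graph is $G=([n],E)$ with $E=\bigcup_j E_j$, and $d=2|E|/n$ is its average degree. All parties see a common random string. In each round the coordinator sends a (nonempty) message to one player, who answers with a (nonempty) message; what is sent depends only on what the sender knows. Eventually the coordinator outputs the answer. The cost of a run is the total number of bits exchanged, and the communication complexity on an input is the expected cost over the randomness. $G$ is $\epsilon$-far from triangle-free if at least $\epsilon|E|$ edges must be added or removed to make it triangle-free. All logarithms are to base $2$. A *triangle-vee* with source $v$ is a pair of edges $\{u,v\},\{v,w\}\in E$ with $\{u,w\}\in E$. A set of triangle-vees is disjoint if any two of its members are edge disjoint or have different sources. For $i\ge 1$ let $B_i=\{v: 3^{i-1}\le \deg(v)<3^i\}$, and let $B_0$ be the set of isolated vertices. $B_i$ is *full* if there are at least $\epsilon|E|/(2\log n)$ disjoint triangle-vees with sources in $B_i$. $B_{\min}$ is the full bucket with the lowest degree; if $B_{\min}=B_i$, put $d(B_{\min})=3^{i-1}$. **Theorem.** For all $\epsilon,\delta\in(0,1)$ there is a constant $C=C(\epsilon,\delta)$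 such that the following holds for all $n\ge 3$ and all $k$. For $a\in\{4,5\}$ and $s \geq 0$ write $$ T_a(s)=C\left(k\,s\,\log^{5/2}n+k^2\log^{a}n\,\log\log n\right). $$ 1. (Finding a triangle, $d$ known.) For every $d>0$ there is a protocol such that on every input (of any average degree) a returned triangle is always a triangle of $G$; and on every input of average degree $d$ the number of bits exchanged is always at most $T_5((nd)^{1/4})=\tilde O(k(nd)^{1/4}+k^2)$. If moreover $G$ is $\epsilon$-far from triangle-free, then a triangle is found with probability at least $1-\delta$; and $B_{\min}$ exists and with probability at least $1-\delta$ the number of bits exchanged is at most $T_5(\sqrt{d(B_{\min})})=\tilde O(k\sqrt{d(B_{\min})}+k^2)$. 2. (Testing, $d$ known.) For every $d>0$ there is a protocol that accepts every triangle-free graph with probability $1$ and that, on every input of average degree $d$, always exchanges at most $T_4((nd)^{1/4})$ bits. If the input has average degree $d$ and is $\epsilon$-far from triangle-free, then it is rejected with probability at least $1-\delta$; and $B_{\min}$ exists and with probability at least $1-\delta$ at most $T_4(\sqrt{d(B_{\min})})$ bits are exchanged. 3. ($d$ unknown.) For each of the two tasks there is a single protocol, not depending on $d$, with the same one-sided error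 on all inputs, whose communication complexity (expected number of bits) on every input is at most $T_5((nd)^{1/4})$ for finding and $T_4((nd)^{1/4})$ for testing, $d$ being the average degree of that input. On every input with $d>0$ that is $\epsilon$-far from triangle-free, it succeeds (finds a triangle, respectively rejects) with probability at least $1-\delta$; and $B_{\min}$ exists and with probability at least $1-\delta$ at most $T_5(\sqrt{d(B_{\min})})$, respectively $T_4(\sqrt{d(B_{\min})})$, bits are exchanged. -/

import Mathlib

/-! ### The coordinator model with shared randomness -/

namespace CoordinatorModel

/-- A message is a nonempty string of bits, so that every message costs at least one bit. -/
abbrev Message : Type := {w : List Bool // w ≠ []}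

/-- The number of bits of a message. -/
def Message.size (w : Message) : ℕ := w.1.length

/-- A deterministic strategy of the coordinator for `k` players. The coordinator either stops with
an output, or starts a round: it sends the message `m` to player `j`, receives the reply of that
player, and continues depending on the reply. -/
inductive Coordinator (k : ℕ) (O : Type) : Type
  | output (o : O) : Coordinator k O
  | round (j : Fin k) (m : Message) (next : Message → Coordinator k O) : Coordinator k O

/-- A deterministic protocol for `k` players with private inputs in `I`. The reply of player `j`
is a function of its own input and of the messages it has received so far (in order, the current
one being the last). The coordinator has no input. -/
structure DetProtocol (k : ℕ) (I O : Type) where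
  coordinator : Coordinator k O
  player : Fin k → I → List Message → Message

/-- Run a coordinator strategy against players whose replies are given by `reply`; `recv j` is the
list of the messages that player `j` has received so far. The result is the output of the
coordinator together with the number of bits exchanged in both directions. -/
def Coordinator.run {k : ℕ} {O : Type} (reply : Fin k → List Message → Message) :
    Coordinator k O → (Fin k → List Message) → O × ℕ
  | .output o, _ => (o, 0)
  | .round j m next, recv =>
      let answer := reply j (recv j ++ [m])
      let rest := Coordinator.run reply (next answer)
        (Function.update recv j (recv j ++ [m]))
      (rest.1, m.size + answer.size + rest.2)

/-- The run of a deterministic protocol on the inputs `X 0, …, X (k - 1)`. -/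
def DetProtocol.run {k : ℕ} {I O : Type} (P : DetProtocol k I O) (X : Fin k → I) : O × ℕ :=
  P.coordinator.run (fun j => P.player j (X j)) (fun _ => [])

/-- A protocol with shared randomness: a deterministic protocol for each value of a random element
of a finite probability space, which the coordinator and all players see. -/
structure Protocol (k : ℕ) (I O : Type) where
  Ω : Type
  fintypeΩ : Fintype Ω
  μ : PMF Ω
  det : Ω → DetProtocol k I O

attribute [instance] Protocol.fintypeΩ

namespace Protocol

variable {k : ℕ} {I O : Type}

/-- The output on the inputs `X` when the shared randomness is `ω`. -/
def out (P : Protocol k I O) (X : Fin k → I) (ω : P.Ω) : O := ((P.det ω).run X).1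

/-- The number of bits exchanged on the inputs `X` when the shared randomness is `ω`. -/
def bits (P : Protocol k I O) (X : Fin k → I) (ω : P.Ω) : ℕ := ((P.det ω).run X).2

open Classical in
/-- The probability of an event over the shared randomness. -/
noncomputable def prob (P : Protocol k I O) (S : P.Ω → Prop) : ℝ :=
  ∑ ω : P.Ω, if S ω then (P.μ ω).toReal else 0

/-- The expected number of bits exchanged on the inputs `X`. -/
noncomputable def expectedBits (P : Protocol k I O) (X : Fin k → I) : ℝ :=
  ∑ ω : P.Ω, (P.μ ω).toReal * (P.bits X ω : ℝ)

end Protocol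

end CoordinatorModel

/-! ### Graphs, distance to triangle-freeness, buckets -/

namespace TriangleTesting

open CoordinatorModel

variable {n k : ℕ}

/-- The graph whose edges are divided among the players, player `j` holding the edges of `X j`.
The edge sets of the players need not be disjoint. -/
def inputGraph (X : Fin k → SimpleGraph (Fin n)) : SimpleGraph (Fin n) := ⨆ j, X j

/-- The number of edges. -/
noncomputable def numEdges (G : SimpleGraph (Fin n)) : ℕ := G.edgeSet.ncard

/-- The average degree. -/
noncomputable def avgDegree (G : SimpleGraph (Fin n)) : ℝ := 2 * (numEdges G : ℝ) / (n : ℝ)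

/-- The degree of a vertex. -/
noncomputable def deg (G : SimpleGraph (Fin n)) (v : Fin n) : ℕ := (G.neighborSet v).ncard

/-- `G` is `ε`-far from the property `Q`: at least `ε |E|` edges have to be added or removed to
turn `G` into a graph with the property. -/
def IsFar (Q : SimpleGraph (Fin n) → Prop) (ε : ℝ) (G : SimpleGraph (Fin n)) : Prop :=
  ∀ H : SimpleGraph (Fin n), Q H →
    ε * (numEdges G : ℝ) ≤ ((symmDiff G.edgeSet H.edgeSet).ncard : ℝ)

/-- `G` contains no triangle. -/
def TriangleFree (G : SimpleGraph (Fin n)) : Prop := G.CliqueFree 3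

/-- The degree buckets: `bucket G 0` consists of the isolated vertices and `bucket G (i + 1)` of
the vertices of degree in `[3 ^ i, 3 ^ (i + 1))`. -/
def bucket (G : SimpleGraph (Fin n)) : ℕ → Set (Fin n)
  | 0 => {v | deg G v = 0}
  | i + 1 => {v | 3 ^ i ≤ deg G v ∧ deg G v < 3 ^ (i + 1)}

/-- The least degree that a vertex of bucket `i` can have. -/
def bucketDegree : ℕ → ℕ
  | 0 => 0
  | i + 1 => 3 ^ i

/-- The pair of edges from `v` to the two end points of `e`. -/
def veeEdges (p : Fin n × Sym2 (Fin n)) : Set (Sym2 (Fin n)) := {f | ∃ u ∈ p.2, f = s(p.1, u)}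

/-- The pair `p = (v, {u, w})` encodes the pair of edges `{u, v}`, `{v, w}` with source `v`; it is a
triangle-vee of `G` if these are edges of `G` and `{u, w}` is an edge of `G` too. -/
def IsTriangleVee (G : SimpleGraph (Fin n)) (p : Fin n × Sym2 (Fin n)) : Prop :=
  p.2 ∈ G.edgeSet ∧ veeEdges p ⊆ G.edgeSet

/-- Any two members of a disjoint set of vees are edge disjoint or have different sources. -/
def DisjointVees (S : Finset (Fin n × Sym2 (Fin n))) : Prop :=
  ∀ p ∈ S, ∀ q ∈ S, p ≠ q → p.1 ≠ q.1 ∨ Disjoint (veeEdges p) (veeEdges q)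

/-- Bucket `i` is full if there are at least `ε |E| / (2 log n)` disjoint triangle-vees whose
sources lie in it. -/
def IsFullBucket (ε : ℝ) (G : SimpleGraph (Fin n)) (i : ℕ) : Prop :=
  ∃ S : Finset (Fin n × Sym2 (Fin n)),
    (∀ p ∈ S, IsTriangleVee G p ∧ p.1 ∈ bucket G i) ∧ DisjointVees S ∧
      ε * (numEdges G : ℝ) / (2 * Real.logb 2 n) ≤ (S.card : ℝ)

/-- `i` is the index of the full bucket of lowest degree. -/
def IsMinFullBucket (ε : ℝ) (G : SimpleGraph (Fin n)) (i : ℕ) : Prop :=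
  IsLeast {i | IsFullBucket ε G i} i

/-! ### The two tasks and the bound -/

/-- Protocols that return a set of vertices (meant to be a triangle) or nothing. -/
abbrev Finder (n k : ℕ) : Type 1 :=
  Protocol k (SimpleGraph (Fin n)) (Option (Finset (Fin n)))

/-- Protocols that accept (`true`) or reject (`false`). -/
abbrev Tester (n k : ℕ) : Type 1 := Protocol k (SimpleGraph (Fin n)) Bool

/-- One-sided error of a finder: on every input, whatever is returned is a triangle of the graph. -/
def Finder.OneSided (P : Finder n k) : Prop :=
  ∀ X ω t, P.out X ω = some t → (inputGraph X).IsNClique 3 t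

/-- One-sided error of a tester: every triangle-free graph is accepted. -/
def Tester.OneSided (P : Tester n k) : Prop :=
  ∀ X ω, TriangleFree (inputGraph X) → P.out X ω = true

/-- The expression `k s log ^ (5/2) n + k² log ^ a n log log n`. -/
noncomputable def commBound (a n k : ℕ) (s : ℝ) : ℝ :=
  (k : ℝ) * s * Real.logb 2 n ^ (5 / 2 : ℝ) +
    (k : ℝ) ^ 2 * Real.logb 2 n ^ a * Real.logb 2 (Real.logb 2 n)

/-- With probability at least `1 - δ` the number of bits that `P` exchanges on `X` is at most `C`
times the bound in which `s` is the square root of the degree of the lowest full bucket. -/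
def CheapByBucket {O : Type} (P : Protocol k (SimpleGraph (Fin n)) O)
    (X : Fin k → SimpleGraph (Fin n)) (ε δ C : ℝ) (a : ℕ) : Prop :=
  ∃ i, IsMinFullBucket ε (inputGraph X) i ∧
    1 - δ ≤ P.prob fun ω => (P.bits X ω : ℝ) ≤ C * commBound a n k (√(bucketDegree i : ℝ))

end TriangleTesting

/-!
Non-adaptive sampling finds a triangle. Let `m` be the number of edges, suppose that the bucket of
the vertices of degree about `D = 3 ^ i` is full, and ignore constants that depend on `ε` and `δ`.
At most `m / D` vertices of this bucket share `m / log n` disjoint triangle-vees, at most `D` at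
each vertex, so `m / (D log n)` of them are rich: the source of `D / log n` disjoint vees
(`exists_isRich`). The public coins choose a set `Q` of vertices, with probability `D log n / m`
each, and a set `R`, with probability `√(log n / D)` each. With high probability `Q` contains a rich
vertex `v` and `R` both end points of some vee with source `v` (`uniformProb_no_vee_le`). If all
players reveal their edges between `Q` and `R` and the coordinator forwards these edges to all
players, a player who holds the third edge sees the triangle. The expected number of edges between
`Q` and `R` is at most `2 m * (D log n / m) * √(log n / D)`, up to constants
`√D * log n ^ (3/2)` (`expect_card_sample_le`); an edge costs `O(log n)` bits, and so a level costs
`k * √D * log n ^ (5/2)` bits. A cap on the number of edges, which by Markov's inequality is rarely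
exceeded, makes this bound hold always.

The protocol goes through the levels `i = 0, 1, …` until a triangle is found. The costs form a
geometric sum, so it is the last level that counts. A graph that is far from triangle-free has many
edge-disjoint triangles (`exists_trianglePacking`), and all but a few of these have two vertices of
degree `O(√m)`, because there are only `O(√m)` other vertices and two vertices lie in at most one of
the triangles. Since there are at most `log₂ n` buckets, one of those of degree `O(√m)` is full
(`exists_isFullBucket`). Hence the levels with `D = O(√m)` suffice, which gives the bound
`k * m ^ (1/4) * log n ^ (5/2)`.

The number `m` is needed up to a constant factor only, for the density of `Q` and for the last
level. If the average degree is unknown, each edge has a public random value in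
`{0, …, n ^ 2 - 1}`, and `n ^ 2` divided by the least value of an edge estimates `m`. The players
announce the logarithm of this quotient for their own edges, and the maximum is the one for the
whole graph (`edgeLevel_inputGraph`), however the edge sets overlap. The estimate is accurate with
high probability (`uniformProb_bad_estimate_le`), and its fourth root has expectation
`O(1 + m ^ (1/4))` (`expect_sqrt_sqrt_le`), which bounds the expected cost. The term quadratic in
`k` in the bound is needed only here, to absorb `O(k * log n ^ (5/2))` bits that are exchanged
however small `m` is.

The coordinator puts a sequence of questions to all players, and a reply depends only on the current
question (`DetProtocol.memoryless`). A tester accepts if the finder returns nothing.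
-/

open scoped BigOperators

/-! ### Memoryless protocols -/

namespace CoordinatorModel

variable {k : ℕ} {I O O' : Type}

/-- The run of a coordinator against players whose replies depend only on the current message. -/
def Coordinator.eval (r : Fin k → Message → Message) : Coordinator k O → O × ℕ
  | .output o => (o, 0)
  | .round j m next =>
      let rest := (next (r j m)).eval r
      (rest.1, m.size + (r j m).size + rest.2)

theorem Coordinator.run_getLastD (r : Fin k → Message → Message) (d : Message)
    (c : Coordinator k O) (recv : Fin k → List Message) :
    c.run (fun j l => r j (l.getLastD d)) recv = c.eval r := by
  induction c generalizing recv with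
  | output o => rfl
  | round j m next ih =>
    simp only [Coordinator.run, Coordinator.eval, List.getLastD_concat, ih]

/-- The deterministic protocol in which the reply of a player is a function of its input and of the
current message only. -/
def DetProtocol.memoryless (c : Coordinator k O) (r : I → Message → Message) :
    DetProtocol k I O where
  coordinator := c
  player _ x l := r x (l.getLastD ⟨[true], by simp⟩)

theorem DetProtocol.run_memoryless (c : Coordinator k O) (r : I → Message → Message)
    (X : Fin k → I) : (memoryless c r).run X = c.eval fun j => r (X j) :=
  Coordinator.run_getLastD (fun j => r (X j)) _ c _

/-- The coordinator sends the message `m` to each of the players in a list and continues depending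
on the list of their replies. -/
def Coordinator.ask (m : Message) (next : List Message → Coordinator k O) :
    List (Fin k) → Coordinator k O
  | [] => next []
  | j :: js => .round j m fun a => ask m (fun as => next (a :: as)) js

theorem Coordinator.eval_ask (r : Fin k → Message → Message) (m : Message)
    (next : List Message → Coordinator k O) (js : List (Fin k)) :
    (ask m next js).eval r =
      (((next (js.map fun j => r j m)).eval r).1,
        (js.map fun j => m.size + (r j m).size).sum +
          ((next (js.map fun j => r j m)).eval r).2) := by
  induction js generalizing next with
  | nil => simp [ask]
  | cons j js ih => simp [ask, Coordinator.eval, ih, add_assoc]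

/-- The coordinator sends the message `m` to all players. -/
def Coordinator.askAll (m : Message) (next : List Message → Coordinator k O) : Coordinator k O :=
  ask m next (List.finRange k)

theorem Coordinator.eval_askAll_fst (r : Fin k → Message → Message) (m : Message)
    (next : List Message → Coordinator k O) :
    ((askAll m next).eval r).1 = ((next ((List.finRange k).map fun j => r j m)).eval r).1 := by
  rw [askAll, eval_ask]

theorem Coordinator.eval_askAll_snd_le (r : Fin k → Message → Message) (m : Message)
    (next : List Message → Coordinator k O) {B : ℝ} (hB : ∀ j, ((r j m).size : ℝ) ≤ B) :
    (((askAll m next).eval r).2 : ℝ) ≤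
      k * (m.size + B) + ((next ((List.finRange k).map fun j => r j m)).eval r).2 := by
  rw [askAll, eval_ask]
  push_cast
  gcongr
  have := List.sum_le_card_nsmul
    (((List.finRange k).map fun j => m.size + (r j m).size).map fun a : ℕ => (a : ℝ))
    (m.size + B) (by simpa using hB)
  rw [List.length_map, List.length_map, List.length_finRange, nsmul_eq_mul] at this
  exact this

/-- Apply a function to the output of a coordinator. -/
def Coordinator.map (f : O → O') : Coordinator k O → Coordinator k O'
  | .output o => .output (f o)
  | .round j m next => .round j m fun a => (next a).map f

theorem Coordinator.run_map (f : O → O') (reply : Fin k → List Message → Message)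
    (c : Coordinator k O) (recv : Fin k → List Message) :
    (c.map f).run reply recv = (f (c.run reply recv).1, (c.run reply recv).2) := by
  induction c generalizing recv with
  | output o => rfl
  | round j m next ih => simp [Coordinator.run, Coordinator.map, ih]

namespace Protocol

/-- Apply a function to the output of a protocol. -/
def map (f : O → O') (P : Protocol k I O) : Protocol k I O' where
  Ω := P.Ω
  fintypeΩ := P.fintypeΩ
  μ := P.μ
  det ω := ⟨(P.det ω).coordinator.map f, (P.det ω).player⟩

theorem out_map (f : O → O') (P : Protocol k I O) (X : Fin k → I) (ω : P.Ω) :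
    (P.map f).out X ω = f (P.out X ω) := by
  simp [Protocol.map, Protocol.out, DetProtocol.run, Coordinator.run_map]

theorem bits_map (f : O → O') (P : Protocol k I O) (X : Fin k → I) (ω : P.Ω) :
    (P.map f).bits X ω = P.bits X ω := by
  simp [Protocol.map, Protocol.bits, DetProtocol.run, Coordinator.run_map]

theorem prob_mono (P : Protocol k I O) {S T : P.Ω → Prop} (h : ∀ ω, S ω → T ω) :
    P.prob S ≤ P.prob T := by
  refine Finset.sum_le_sum fun ω _ => ?_
  by_cases hS : S ω
  · simp [hS, h ω hS]
  · simp only [hS, if_false]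
    split_ifs <;> simp

/-- The protocol whose shared randomness is uniform on `Ω`. -/
noncomputable def uniform (Ω : Type) [Fintype Ω] [Nonempty Ω] (det : Ω → DetProtocol k I O) :
    Protocol k I O where
  Ω := Ω
  fintypeΩ := inferInstance
  μ := PMF.uniformOfFintype Ω
  det := det

theorem toReal_uniformOfFintype {Ω : Type} [Fintype Ω] [Nonempty Ω] (ω : Ω) :
    (PMF.uniformOfFintype Ω ω).toReal = (Fintype.card Ω : ℝ)⁻¹ := by
  rw [PMF.uniformOfFintype_apply]
  simp

/-- The probability of an event under the uniform distribution. -/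
noncomputable def _root_.uniformProb {Ω : Type*} [Fintype Ω] (S : Ω → Prop) : ℝ :=
  open Classical in 𝔼 ω, if S ω then (1 : ℝ) else 0

theorem prob_uniform {Ω : Type} [Fintype Ω] [Nonempty Ω] (det : Ω → DetProtocol k I O)
    (S : Ω → Prop) : (uniform Ω det).prob S = uniformProb S := by
  rw [uniformProb, Fintype.expect_eq_sum_div_card, Finset.sum_div]
  refine Finset.sum_congr rfl fun (ω : Ω) _ => ?_
  split_ifs
  · rw [one_div]
    exact toReal_uniformOfFintype ω
  · simp

theorem expectedBits_uniform {Ω : Type} [Fintype Ω] [Nonempty Ω] (det : Ω → DetProtocol k I O)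
    (X : Fin k → I) : (uniform Ω det).expectedBits X = 𝔼 ω, (((det ω).run X).2 : ℝ) := by
  rw [Fintype.expect_eq_sum_div_card, Finset.sum_div]
  refine Finset.sum_congr rfl fun (ω : Ω) _ => ?_
  rw [div_eq_inv_mul]
  exact congrArg (· * (((det ω).run X).2 : ℝ)) (toReal_uniformOfFintype ω)

end Protocol

/-! ### Binary encodings -/

/-- The message consisting of `x + 1` ones, which stands for the number `x`. -/
def unary (x : ℕ) : Message := ⟨List.replicate (x + 1) true, by simp⟩

@[simp] theorem size_unary (x : ℕ) : (unary x).size = x + 1 := by simp [unary, Message.size]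

/-- If `α` has at most `2 ^ b` elements, then a subset of `α` with `c` elements can be encoded by
`b * c + 1` bits. -/
theorem exists_finset_encoding (α : Type) [Fintype α] {b : ℕ} (hb : b ≠ 0)
    (h : Fintype.card α ≤ 2 ^ b) :
    ∃ enc : Finset α → Message, enc.Injective ∧ ∀ U, (enc U).size = b * U.card + 1 := by
  classical
  have emb (c : ℕ) : Nonempty ({U : Finset α // U.card = c} ↪ (Fin (b * c + 1) → Bool)) := by
    refine Function.Embedding.nonempty_of_card_le ?_
    rw [Fintype.card_finset_len, Fintype.card_fun, Fintype.card_bool, Fintype.card_fin]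
    calc (Fintype.card α).choose c ≤ Fintype.card α ^ c := Nat.choose_le_pow _ _
      _ ≤ (2 ^ b) ^ c := Nat.pow_le_pow_left h c
      _ = 2 ^ (b * c) := (pow_mul _ _ _).symm
      _ ≤ 2 ^ (b * c + 1) := Nat.pow_le_pow_right two_pos (Nat.le_succ _)
  let e (c : ℕ) := (emb c).some
  have key (c d : ℕ) (U : {U : Finset α // U.card = c}) (V : {V : Finset α // V.card = d})
      (hUV : List.ofFn (e c U) = List.ofFn (e d V)) : U.1 = V.1 := by
    have hcd : c = d := by simpa [hb] using congrArg List.length hUV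
    subst hcd
    rw [(e c).injective (List.ofFn_injective hUV)]
  exact ⟨fun U => ⟨List.ofFn (e U.card ⟨U, rfl⟩), by simp⟩,
    fun U V hUV => key _ _ _ _ (congrArg Subtype.val hUV), fun U => by simp [Message.size]⟩

end CoordinatorModel

/-! ### Uniform probability on finite sets -/

section UniformProb

variable {Ω Ω' : Type*} [Fintype Ω] [Fintype Ω']

theorem uniformProb_def (S : Ω → Prop) [DecidablePred S] :
    uniformProb S = 𝔼 ω, if S ω then (1 : ℝ) else 0 := by
  rw [uniformProb]
  congr!

theorem uniformProb_mono {S T : Ω → Prop} (h : ∀ ω, S ω → T ω) :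
    uniformProb S ≤ uniformProb T := by
  classical
  refine Finset.expect_le_expect fun ω _ => ?_
  by_cases hS : S ω
  · simp [hS, h ω hS]
  · simp only [hS, if_false]
    split_ifs <;> simp

theorem uniformProb_nonneg (S : Ω → Prop) : 0 ≤ uniformProb S :=
  Finset.expect_nonneg fun ω _ => by split_ifs <;> simp

theorem uniformProb_or_le (S T : Ω → Prop) :
    uniformProb (fun ω => S ω ∨ T ω) ≤ uniformProb S + uniformProb T := by
  classical
  rw [uniformProb, uniformProb, uniformProb, ← Finset.expect_add_distrib]
  refine Finset.expect_le_expect fun ω _ => ?_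
  by_cases hS : S ω <;> by_cases hT : T ω <;> simp [hS, hT]

theorem uniformProb_exists_le {ι : Type*} (s : Finset ι) (S : ι → Ω → Prop) :
    uniformProb (fun ω => ∃ i ∈ s, S i ω) ≤ ∑ i ∈ s, uniformProb (S i) := by
  classical
  simp only [uniformProb]
  rw [← Finset.expect_sum_comm]
  refine Finset.expect_le_expect fun ω _ => ?_
  split_ifs with h
  · obtain ⟨i, hi, hS⟩ := h
    calc (1 : ℝ) = if S i ω then 1 else 0 := by simp [hS]
      _ ≤ _ := Finset.single_le_sum (f := fun i => if S i ω then (1 : ℝ) else 0)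
        (fun i _ => by split_ifs <;> simp) hi
  · exact Finset.sum_nonneg fun i _ => by split_ifs <;> simp

theorem uniformProb_not [Nonempty Ω] (S : Ω → Prop) :
    uniformProb (fun ω => ¬ S ω) = 1 - uniformProb S := by
  classical
  have h : (1 : ℝ) = 𝔼 _ω : Ω, (1 : ℝ) := (Fintype.expect_const 1).symm
  rw [h, uniformProb, uniformProb, ← Finset.expect_sub_distrib]
  refine Finset.expect_congr rfl fun ω _ => ?_
  by_cases hS : S ω <;> simp [hS]

theorem uniformProb_le_one [Nonempty Ω] (S : Ω → Prop) : uniformProb S ≤ 1 := by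
  have h1 := uniformProb_not S
  have h2 := uniformProb_nonneg fun ω => ¬ S ω
  linarith

/-- Markov's inequality. -/
theorem uniformProb_lt_le {Y : Ω → ℝ} (hY : ∀ ω, 0 ≤ Y ω) {a : ℝ} (ha : 0 < a) :
    uniformProb (fun ω => a < Y ω) ≤ (𝔼 ω, Y ω) / a := by
  classical
  rw [uniformProb, Finset.expect_div]
  refine Finset.expect_le_expect fun ω _ => ?_
  split_ifs with h
  · rw [le_div_iff₀ ha]
    linarith
  · exact div_nonneg (hY ω) ha.le

theorem expect_prod_type (F : Ω × Ω' → ℝ) : 𝔼 ω, F ω = 𝔼 a, 𝔼 b, F (a, b) := by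
  rw [← Finset.univ_product_univ, Finset.expect_product]

theorem uniformProb_prod (S : Ω × Ω' → Prop) :
    uniformProb S = 𝔼 a, uniformProb fun b => S (a, b) :=
  expect_prod_type _

theorem uniformProb_prod_le [Nonempty Ω] {S : Ω × Ω' → Prop} {c : ℝ}
    (h : ∀ a, uniformProb (fun b => S (a, b)) ≤ c) : uniformProb S ≤ c := by
  rw [uniformProb_prod]
  exact Finset.expect_le Finset.univ_nonempty fun a _ => h a

theorem uniformProb_fst [Nonempty Ω'] (S : Ω → Prop) :
    uniformProb (fun ω : Ω × Ω' => S ω.1) = uniformProb S := by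
  classical
  rw [uniformProb_prod, uniformProb_def S]
  simp only [uniformProb_def]
  exact Finset.expect_congr rfl fun a _ => Fintype.expect_const _

theorem uniformProb_snd [Nonempty Ω] (S : Ω' → Prop) :
    uniformProb (fun ω : Ω × Ω' => S ω.2) = uniformProb S := by
  rw [uniformProb_prod]
  exact Fintype.expect_const (uniformProb S)

theorem uniformProb_and_prod (S : Ω → Prop) (T : Ω' → Prop) :
    uniformProb (fun ω : Ω × Ω' => S ω.1 ∧ T ω.2) = uniformProb S * uniformProb T := by
  classical
  rw [uniformProb_prod]
  simp only [uniformProb]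
  rw [Finset.expect_mul]
  refine Finset.expect_congr rfl fun a _ => ?_
  by_cases h : S a <;> simp [h]

theorem one_sub_uniformProb_pow_le [Nonempty Ω] (S : Ω → Prop) {x : ℝ} (c : ℕ)
    (h : 1 - uniformProb S ≤ Real.exp (-x)) : (1 - uniformProb S) ^ c ≤ Real.exp (-(x * c)) := by
  refine (pow_le_pow_left₀ (by linarith [uniformProb_le_one S]) h c).trans_eq ?_
  rw [← Real.exp_nat_mul]
  congr 1
  ring

/-! ### Random functions -/

variable {α β ι : Type*} [Fintype α] [DecidableEq α] [Fintype β] [Nonempty β]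

/-- The values of a random function are independent. -/
theorem expect_prod_apply (A : Finset α) (h : α → β → ℝ) :
    𝔼 g : α → β, ∏ v ∈ A, h v (g v) = ∏ v ∈ A, 𝔼 x, h v x := by
  classical
  have h1 (g : α → β) : ∏ v ∈ A, h v (g v) = ∏ v, if v ∈ A then h v (g v) else 1 := by
    rw [Finset.prod_ite_mem, Finset.univ_inter]
  have h2 : ∏ v ∈ A, 𝔼 x, h v x = ∏ v, 𝔼 x, if v ∈ A then h v x else 1 := by
    have (v : α) : (𝔼 x, if v ∈ A then h v x else 1) = if v ∈ A then 𝔼 x, h v x else 1 := by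
      by_cases hv : v ∈ A <;> simp [hv]
    simp only [this]
    rw [Finset.prod_ite_mem, Finset.univ_inter]
  rw [h2]
  simp only [h1, Fintype.expect_eq_sum_div_card]
  rw [Finset.prod_div_distrib, Finset.prod_univ_sum, Fintype.piFinset_univ]
  simp

theorem expect_prod_comp (I : Finset ι) {u : ι → α} (hu : Set.InjOn u I) (h : ι → β → ℝ) :
    𝔼 g : α → β, ∏ i ∈ I, h i (g (u i)) = ∏ i ∈ I, 𝔼 x, h i x := by
  classical
  rcases I.eq_empty_or_nonempty with rfl | ⟨i₀, hi₀⟩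
  · simp
  have : Nonempty ι := ⟨i₀⟩
  have hinv (i : ι) (hi : i ∈ I) : Function.invFunOn u I (u i) = i :=
    hu.leftInvOn_invFunOn hi
  have key := expect_prod_apply (I.image u) fun v => h (Function.invFunOn u I v)
  rw [Finset.prod_image hu] at key
  rw [Finset.prod_congr rfl fun i hi => by rw [hinv i hi]] at key
  rw [← key]
  refine Finset.expect_congr rfl fun g _ => ?_
  rw [Finset.prod_image hu]
  exact Finset.prod_congr rfl fun i hi => by rw [hinv i hi]

theorem uniformProb_apply (v : α) (S : β → Prop) :
    uniformProb (fun g : α → β => S (g v)) = uniformProb S := by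
  classical
  have := expect_prod_apply {v} fun _ x => if S x then (1 : ℝ) else 0
  simpa [uniformProb] using this

/-- The probability that a random function avoids `S` on `A`. -/
theorem uniformProb_forall_not (A : Finset α) (S : β → Prop) :
    uniformProb (fun g : α → β => ∀ v ∈ A, ¬ S (g v)) = (1 - uniformProb S) ^ A.card := by
  classical
  have := expect_prod_apply A fun _ x => if ¬ S x then (1 : ℝ) else 0
  simp only [Finset.prod_boole, ← uniformProb_def] at this
  rw [uniformProb_not, Finset.prod_const] at this
  rw [← this, uniformProb]
  congr!

/-- If the pairs `(u i, w i)` have distinct first and distinct second components, then the events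
that both `g₁ (u i)` and `g₂ (w i)` lie in `S`, for independent random functions `g₁` and `g₂`, are
independent. -/
theorem uniformProb_forall_not_pair (I : Finset ι) {u w : ι → α} (hu : Set.InjOn u I)
    (hw : Set.InjOn w I) (S : β → Prop) :
    uniformProb (fun g : (α → β) × (α → β) => ∀ i ∈ I, ¬ (S (g.1 (u i)) ∧ S (g.2 (w i)))) =
      (1 - uniformProb S ^ 2) ^ I.card := by
  classical
  rw [uniformProb_prod]
  -- For fixed `g₁` the events depend on different values of `g₂`.
  have h1 (g₁ : α → β) :
      uniformProb (fun g₂ : α → β => ∀ i ∈ I, ¬ (S (g₁ (u i)) ∧ S (g₂ (w i)))) =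
        ∏ i ∈ I, (1 - (if S (g₁ (u i)) then (1 : ℝ) else 0) * uniformProb S) := by
    have := expect_prod_comp (β := β) I hw
      fun i x => if ¬ (S (g₁ (u i)) ∧ S x) then (1 : ℝ) else 0
    simp only [Finset.prod_boole] at this
    rw [uniformProb_def, this]
    refine Finset.prod_congr rfl fun i _ => ?_
    by_cases h : S (g₁ (u i))
    · simp only [h, true_and, if_true, one_mul]
      rw [← uniformProb_not, uniformProb_def]
    · simp [h]
  simp only [h1]
  rw [expect_prod_comp I hu fun _ x => 1 - (if S x then (1 : ℝ) else 0) * uniformProb S,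
    Finset.prod_const]
  congr 1
  rw [Finset.expect_sub_distrib, ← Finset.expect_mul, Fintype.expect_const, sq, uniformProb_def S]

end UniformProb

/-! ### Thresholds -/

section Threshold

variable {N : ℕ}

theorem uniformProb_lt (a : ℕ) :
    uniformProb (fun x : Fin N => (x : ℕ) < a) = (min N a : ℕ) / (N : ℝ) := by
  classical
  rw [uniformProb_def, Fintype.expect_eq_sum_div_card, Finset.sum_boole, Fintype.card_fin,
    ← Fin.card_filter_val_lt]

variable [NeZero N]

theorem uniformProb_lt_ceil_le {p : ℝ} (hN : 1 ≤ p * N) :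
    uniformProb (fun x : Fin N => (x : ℕ) < ⌈p * N⌉₊) ≤ 2 * p := by
  have hN0 : (0 : ℝ) < N := Nat.cast_pos.2 (NeZero.pos N)
  rw [uniformProb_lt, div_le_iff₀ hN0]
  calc ((min N ⌈p * N⌉₊ : ℕ) : ℝ) ≤ (⌈p * N⌉₊ : ℝ) := by exact_mod_cast min_le_right _ _
    _ ≤ p * N + 1 := (Nat.ceil_lt_add_one (zero_le_one.trans hN)).le
    _ ≤ 2 * p * N := by linarith

theorem min_one_le_uniformProb_lt_ceil (p : ℝ) :
    min 1 p ≤ uniformProb (fun x : Fin N => (x : ℕ) < ⌈p * N⌉₊) := by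
  have hN0 : (0 : ℝ) < N := Nat.cast_pos.2 (NeZero.pos N)
  rw [uniformProb_lt, le_div_iff₀ hN0, Nat.cast_min, min_mul_of_nonneg _ _ hN0.le, one_mul]
  exact min_le_min_left _ (Nat.le_ceil _)

theorem one_sub_uniformProb_lt_ceil_le (p : ℝ) :
    1 - uniformProb (fun x : Fin N => (x : ℕ) < ⌈p * N⌉₊) ≤ Real.exp (-p) := by
  have h := min_one_le_uniformProb_lt_ceil (N := N) p
  have := Real.one_sub_le_exp_neg p
  have := Real.exp_pos (-p)
  rcases min_choice 1 p with h' | h' <;> rw [h'] at h <;> linarith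

theorem one_sub_uniformProb_lt_ceil_sq_le {p : ℝ} (hp : 0 ≤ p) :
    1 - uniformProb (fun x : Fin N => (x : ℕ) < ⌈p * N⌉₊) ^ 2 ≤ Real.exp (-p ^ 2) := by
  have h := min_one_le_uniformProb_lt_ceil (N := N) p
  have := Real.one_sub_le_exp_neg (p ^ 2)
  have := Real.exp_pos (-p ^ 2)
  rcases min_choice 1 p with h' | h' <;> rw [h'] at h <;> nlinarith

end Threshold

namespace TriangleTesting

section Graphs

/-! ### Degrees and numbers of edges -/

variable {n : ℕ}

theorem numEdges_eq_card (G : SimpleGraph (Fin n)) [DecidableRel G.Adj] :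
    numEdges G = G.edgeFinset.card := by
  rw [numEdges, ← SimpleGraph.coe_edgeFinset, Set.ncard_coe_finset]

theorem deg_eq_degree (G : SimpleGraph (Fin n)) [DecidableRel G.Adj] (v : Fin n) :
    deg G v = G.degree v := by
  rw [SimpleGraph.degree, ← Set.ncard_coe_finset, SimpleGraph.coe_neighborFinset]
  rfl

theorem sum_deg (G : SimpleGraph (Fin n)) : ∑ v, deg G v = 2 * numEdges G := by
  classical
  simp only [deg_eq_degree, numEdges_eq_card]
  exact G.sum_degrees_eq_twice_card_edges

theorem card_adj_pairs (G : SimpleGraph (Fin n))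
    [DecidablePred fun p : Fin n × Fin n => G.Adj p.1 p.2] :
    (Finset.univ.filter fun p : Fin n × Fin n => G.Adj p.1 p.2).card = 2 * numEdges G := by
  classical
  rw [← sum_deg, ← Finset.univ_product_univ, Finset.card_filter, Finset.sum_product]
  refine Finset.sum_congr rfl fun v _ => ?_
  rw [deg_eq_degree, ← Finset.card_filter, SimpleGraph.degree, SimpleGraph.neighborFinset_eq_filter]
  congr!

theorem card_edges (G : SimpleGraph (Fin n)) [DecidablePred (· ∈ G.edgeSet)] :
    (Finset.univ.filter fun e => e ∈ G.edgeSet).card = numEdges G := by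
  rw [numEdges, ← Set.ncard_coe_finset]
  congr
  ext e
  simp

theorem deg_lt (G : SimpleGraph (Fin n)) (v : Fin n) : deg G v < n := by
  classical
  rw [deg_eq_degree]
  simpa using G.degree_lt_card_verts v

theorem numEdges_le (G : SimpleGraph (Fin n)) : 2 * numEdges G ≤ n ^ 2 := by
  rw [← sum_deg, sq]
  calc ∑ v, deg G v ≤ ∑ _v : Fin n, n := Finset.sum_le_sum fun v _ => (deg_lt G v).le
    _ = n * n := by simp

theorem card_mul_le_of_le_deg (G : SimpleGraph (Fin n)) (V : Finset (Fin n)) {D : ℝ}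
    (h : ∀ v ∈ V, D ≤ deg G v) : V.card * D ≤ 2 * numEdges G := by
  calc (V.card : ℝ) * D = ∑ _v ∈ V, D := by simp
    _ ≤ ∑ v ∈ V, (deg G v : ℝ) := Finset.sum_le_sum h
    _ ≤ ∑ v, (deg G v : ℝ) :=
      Finset.sum_le_sum_of_subset_of_nonneg (Finset.subset_univ _) fun _ _ _ => Nat.cast_nonneg _
    _ = 2 * numEdges G := by exact_mod_cast sum_deg G

/-! ### Packing triangles -/

/-- A family of pairwise edge-disjoint triangles. -/
structure IsTrianglePacking (G : SimpleGraph (Fin n)) (T : Finset (Finset (Fin n))) : Prop where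
  isNClique : ∀ t ∈ T, G.IsNClique 3 t
  card_inter_le : ∀ s ∈ T, ∀ t ∈ T, s ≠ t → (s ∩ t).card ≤ 1

theorem IsTrianglePacking.eq_of_mem {G : SimpleGraph (Fin n)} {T : Finset (Finset (Fin n))}
    (hT : IsTrianglePacking G T) {s t : Finset (Fin n)} (hs : s ∈ T) (ht : t ∈ T) {a b : Fin n}
    (hab : a ≠ b) (has : a ∈ s) (hbs : b ∈ s) (hat : a ∈ t) (hbt : b ∈ t) : s = t := by
  by_contra hne
  refine hab (Finset.card_le_one.1 (hT.card_inter_le s hs t ht hne) a ?_ b ?_) <;>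
    simp [*]

/-- Deleting the edges of the triangles of a maximal packing makes the graph triangle-free, so a
graph that is far from triangle-free has a large packing. -/
theorem exists_trianglePacking {ε : ℝ} {G : SimpleGraph (Fin n)} (hG : IsFar TriangleFree ε G) :
    ∃ T, IsTrianglePacking G T ∧ ε * numEdges G ≤ 3 * T.card := by
  classical
  obtain ⟨T, hT⟩ := (Set.toFinite {T | IsTrianglePacking G T}).exists_maximal
    ⟨∅, ⟨by simp, by simp⟩⟩
  have hP : IsTrianglePacking G T := hT.prop
  refine ⟨T, hP, ?_⟩
  let R : Set (Sym2 (Fin n)) := {e | ∃ t ∈ T, ∀ x ∈ e, x ∈ t}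
  have hfree : TriangleFree (G.deleteEdges R) := by
    intro s hs
    have key (t : Finset (Fin n)) (ht : t ∈ T) : (s ∩ t).card ≤ 1 := by
      rw [Finset.card_le_one]
      intro a ha b hb
      by_contra hab
      rw [Finset.mem_inter] at ha hb
      have := hs.1 ha.1 hb.1 hab
      rw [SimpleGraph.deleteEdges_adj] at this
      exact this.2 ⟨t, ht, by simp [ha.2, hb.2]⟩
    have hins : IsTrianglePacking G (insert s T) := by
      constructor
      · intro t ht
        rcases Finset.mem_insert.1 ht with rfl | ht
        · exact hs.mono (G.deleteEdges_le R)
        · exact hP.isNClique t ht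
      · intro t ht t' ht' hne
        rcases Finset.mem_insert.1 ht with h | h <;>
          rcases Finset.mem_insert.1 ht' with h' | h'
        · exact absurd (h.trans h'.symm) hne
        · rw [h]
          exact key _ h'
        · rw [h', Finset.inter_comm]
          exact key _ h
        · exact hP.card_inter_le _ h _ h' hne
    have hsT : s ∈ T := hT.le_of_ge hins (Finset.subset_insert s T) (Finset.mem_insert_self s T)
    have := key s hsT
    rw [Finset.inter_self, hs.card_eq] at this
    omega
  have h1 := hG _ hfree
  have h2 : symmDiff G.edgeSet (G.deleteEdges R).edgeSet ⊆
      ↑(T.biUnion fun t => t.offDiag.image Sym2.mk.uncurry) := by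
    intro e he
    rw [SimpleGraph.edgeSet_deleteEdges, Set.mem_symmDiff] at he
    have he' : e ∈ G.edgeSet ∧ e ∈ R := by
      rcases he with ⟨h, h'⟩ | ⟨h, h'⟩
      · exact ⟨h, by_contra fun h2 => h' ⟨h, h2⟩⟩
      · exact absurd h.1 h'
    obtain ⟨he, t, ht, htm⟩ := he'
    induction e using Sym2.ind with
    | _ a b =>
      simp only [Finset.coe_biUnion, Set.mem_iUnion]
      refine ⟨t, ht, ?_⟩
      rw [Finset.coe_image]
      refine ⟨(a, b), ?_, rfl⟩
      have := G.ne_of_adj he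
      simp only [Finset.coe_offDiag, Set.mem_offDiag]
      exact ⟨htm a (by simp), htm b (by simp), this⟩
  have h3 : (symmDiff G.edgeSet (G.deleteEdges R).edgeSet).ncard ≤ T.card * 3 := by
    refine (Set.ncard_le_ncard h2).trans ?_
    rw [Set.ncard_coe_finset]
    refine Finset.card_biUnion_le_card_mul _ _ _ fun t ht => ?_
    rw [Sym2.card_image_offDiag, (hP.isNClique t ht).card_eq]
    rfl
  calc ε * numEdges G ≤ _ := h1
    _ ≤ ((T.card * 3 : ℕ) : ℝ) := by exact_mod_cast h3
    _ = 3 * T.card := by push_cast; ring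

open Classical in
/-- The triangle-vees of the triangles of a packing whose sources lie in `L`. -/
noncomputable def packingVees (T : Finset (Finset (Fin n))) (L : Finset (Fin n)) :
    Finset (Fin n × Sym2 (Fin n)) :=
  Finset.univ.filter fun p => p.1 ∈ L ∧ p.1 ∉ p.2 ∧ insert p.1 p.2.toFinset ∈ T

theorem isTriangleVee_of_mem_packingVees {G : SimpleGraph (Fin n)} {T : Finset (Finset (Fin n))}
    (hT : IsTrianglePacking G T) {L : Finset (Fin n)} {p : Fin n × Sym2 (Fin n)}
    (hp : p ∈ packingVees T L) : IsTriangleVee G p := by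
  classical
  obtain ⟨v, e⟩ := p
  simp only [packingVees, Finset.mem_filter] at hp
  obtain ⟨-, -, -, hp⟩ := hp
  induction e using Sym2.ind with
  | _ a b =>
    rw [Sym2.toFinset_mk_eq] at hp
    obtain ⟨h1, h2, h3⟩ := SimpleGraph.is3Clique_triple_iff.1 (hT.isNClique _ (by convert hp))
    refine ⟨h3, ?_⟩
    rintro f ⟨x, hx, rfl⟩
    rcases Sym2.mem_iff.1 hx with rfl | rfl
    · exact h1
    · exact h2

theorem disjointVees_packingVees {G : SimpleGraph (Fin n)} {T : Finset (Finset (Fin n))}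
    (hT : IsTrianglePacking G T) (L : Finset (Fin n)) : DisjointVees (packingVees T L) := by
  classical
  rintro ⟨v, e⟩ hp ⟨v', e'⟩ hq hne
  by_contra! h
  obtain ⟨rfl, h⟩ := h
  obtain ⟨f, ⟨x, hx, rfl⟩, ⟨y, hy, hxy⟩⟩ := Set.not_disjoint_iff.1 h
  have hxy : x = y := by
    rcases Sym2.eq_iff.1 hxy with ⟨-, h⟩ | ⟨h1, h2⟩
    · exact h
    · exact h2.trans h1
  subst hxy
  simp only [packingVees, Finset.mem_filter, Finset.mem_univ, true_and] at hp hq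
  refine hne ?_
  have hvx : v ≠ x := by
    rintro rfl
    exact hp.2.1 hx
  have heq := hT.eq_of_mem hp.2.2 hq.2.2 hvx (by simp) (by simp [hx]) (by simp) (by simp [hy])
  have h2 : e.toFinset = e'.toFinset := by
    have := congrArg (fun s => s.erase v) heq
    simpa [hp.2.1, hq.2.1] using this
  have : e = e' := by
    ext z
    rw [← Sym2.mem_toFinset, h2, Sym2.mem_toFinset]
  rw [this]

theorem sum_card_inter_le_card_packingVees {G : SimpleGraph (Fin n)}
    {T : Finset (Finset (Fin n))} (hT : IsTrianglePacking G T) (L : Finset (Fin n)) :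
    ∑ t ∈ T, (t ∩ L).card ≤ (packingVees T L).card := by
  classical
  rw [← Finset.card_sigma]
  refine Finset.card_le_card_of_surjOn
    (fun p => (⟨insert p.1 p.2.toFinset, p.1⟩ : Σ _ : Finset (Fin n), Fin n)) ?_
  rintro ⟨t, v⟩ htv
  simp only [Finset.coe_sigma, Set.mem_sigma_iff, Finset.mem_coe, Finset.mem_inter] at htv
  obtain ⟨ht, hvt, hvL⟩ := htv
  have h2 : (t.erase v).card = 2 := by
    rw [Finset.card_erase_of_mem hvt, (hT.isNClique t ht).card_eq]
  obtain ⟨a, b, -, hab⟩ := Finset.card_eq_two.1 h2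
  have hv : v ∉ t.erase v := by simp
  have hins : insert v ({a, b} : Finset (Fin n)) = t := by rw [← hab, Finset.insert_erase hvt]
  rw [hab] at hv
  refine ⟨(v, s(a, b)), ?_, ?_⟩
  · simp only [packingVees, Finset.coe_filter, Finset.mem_univ, true_and, Set.mem_ofPred_eq]
    refine ⟨hvL, by simpa using hv, ?_⟩
    rw [Sym2.toFinset_mk_eq]
    convert ht
  · simp only [Sym2.toFinset_mk_eq, hins]

/-- All but a few triangles of a packing have two vertices in `L` if its complement is small: two
vertices outside `L` belong to at most one triangle. -/
theorem two_mul_card_le_sum_card_inter {G : SimpleGraph (Fin n)} {T : Finset (Finset (Fin n))}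
    (hT : IsTrianglePacking G T) (L : Finset (Fin n)) :
    2 * T.card ≤ ∑ t ∈ T, (t ∩ L).card + 2 * Lᶜ.card ^ 2 := by
  classical
  have hsplit := Finset.card_filter_add_card_filter_not (s := T) fun t => 2 ≤ (t \ L).card
  have hbad : (T.filter fun t => 2 ≤ (t \ L).card).card ≤ Lᶜ.card ^ 2 := by
    have hex (t : Finset (Fin n)) (ht : t ∈ T.filter fun t => 2 ≤ (t \ L).card) :
        ∃ p : Fin n × Fin n, p.1 ∈ t \ L ∧ p.2 ∈ t \ L ∧ p.1 ≠ p.2 := by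
      obtain ⟨a, ha, b, hb, hab⟩ := Finset.one_lt_card.1 (Finset.mem_filter.1 ht).2
      exact ⟨(a, b), ha, hb, hab⟩
    have : Nonempty (Fin n × Fin n) ∨ (T.filter fun t => 2 ≤ (t \ L).card) = ∅ := by
      rcases (T.filter fun t => 2 ≤ (t \ L).card).eq_empty_or_nonempty with h | ⟨t, ht⟩
      · exact Or.inr h
      · exact Or.inl ⟨(hex t ht).choose⟩
    rcases this with _ | h
    swap
    · simp [h]
    choose! f hf using hex
    rw [sq, ← Finset.card_product]
    refine Finset.card_le_card_of_injOn f (fun t ht => ?_) fun s hs t ht hst => ?_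
    · have := hf t ht
      simp only [Finset.mem_sdiff] at this
      simp [this]
    · have h1 := hf s hs
      have h2 := hf t ht
      rw [← hst] at h2
      simp only [Finset.mem_sdiff] at h1 h2
      exact hT.eq_of_mem (Finset.mem_filter.1 hs).1 (Finset.mem_filter.1 ht).1 h1.2.2
        h1.1.1 h1.2.1.1 h2.1.1 h2.2.1.1
  have hgood : (T.filter fun t => ¬ 2 ≤ (t \ L).card).card * 2 ≤ ∑ t ∈ T, (t ∩ L).card := by
    calc (T.filter fun t => ¬ 2 ≤ (t \ L).card).card * 2
        = ∑ _t ∈ T.filter fun t => ¬ 2 ≤ (t \ L).card, 2 := by simp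
      _ ≤ ∑ t ∈ T.filter fun t => ¬ 2 ≤ (t \ L).card, (t ∩ L).card := by
        refine Finset.sum_le_sum fun t ht => ?_
        obtain ⟨ht, h2⟩ := Finset.mem_filter.1 ht
        have h3 := Finset.card_sdiff_add_card_inter t L
        rw [(hT.isNClique t ht).card_eq] at h3
        omega
      _ ≤ ∑ t ∈ T, (t ∩ L).card :=
        Finset.sum_le_sum_of_subset (Finset.filter_subset _ _)
  omega

/-! ### Full buckets -/

theorem mem_bucket_log {G : SimpleGraph (Fin n)} {v : Fin n} (hv : deg G v ≠ 0) :
    v ∈ bucket G (Nat.log 3 (deg G v) + 1) :=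
  ⟨Nat.pow_log_le_self 3 hv, Nat.lt_pow_succ_log_self (by norm_num) _⟩

theorem two_pow_succ_le (i : ℕ) : 2 ^ (i + 1) ≤ 3 ^ i + 1 := by
  induction i with
  | zero => norm_num
  | succ i ih =>
    have : 1 ≤ 3 ^ i := Nat.one_le_pow _ _ (by norm_num)
    rw [pow_succ, pow_succ 3]
    omega

theorem log_deg_lt {G : SimpleGraph (Fin n)} {v : Fin n} (hv : deg G v ≠ 0) :
    Nat.log 3 (deg G v) < Nat.log 2 n := by
  have h1 := Nat.pow_log_le_self 3 hv
  have h2 := deg_lt G v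
  have h3 := two_pow_succ_le (Nat.log 3 (deg G v))
  exact Nat.le_log_of_pow_le (by norm_num) (by omega)

theorem deg_ne_zero_of_isTriangleVee {G : SimpleGraph (Fin n)} {p : Fin n × Sym2 (Fin n)}
    (hp : IsTriangleVee G p) : deg G p.1 ≠ 0 := by
  have h : s(p.1, p.2.out.1) ∈ G.edgeSet := hp.2 ⟨_, Sym2.out_fst_mem p.2, rfl⟩
  exact Set.ncard_ne_zero_of_mem (s := G.neighborSet p.1) h

theorem natLog_le_logb (n : ℕ) : (Nat.log 2 n : ℝ) ≤ Real.logb 2 n := by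
  simpa using Real.natLog_le_logb n 2

/-- In a graph that is far from triangle-free, some bucket of degree `O(√|E|)` is full: there are
few vertices of larger degree, so most triangles of a packing have two vertices of small degree. -/
theorem exists_isFullBucket {ε : ℝ} (hε : 0 < ε) {G : SimpleGraph (Fin n)} (hn : 2 ≤ n)
    (hm : 0 < numEdges G) (hG : IsFar TriangleFree ε G) :
    ∃ i, IsFullBucket ε G (i + 1) ∧ (3 : ℝ) ^ i ≤ √(48 / ε) * √(numEdges G) := by
  classical
  obtain ⟨T, hT, hTcard⟩ := exists_trianglePacking hG
  set m : ℝ := (numEdges G : ℝ) with hmdef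
  have hm0 : 0 < m := Nat.cast_pos.2 hm
  set c : ℝ := √(48 / ε) * √m with hc
  have hc0 : 0 < c := by positivity
  have hc2 : c ^ 2 = 48 / ε * m := by
    rw [hc, mul_pow, Real.sq_sqrt (by positivity), Real.sq_sqrt hm0.le]
  let L : Finset (Fin n) := Finset.univ.filter fun v => (deg G v : ℝ) ≤ c
  -- The degrees sum to `2 * m`, so at most `2 * m / c` of the vertices have degree above `c`.
  have hHigh : (Lᶜ.card : ℝ) ^ 2 ≤ ε * m / 12 := by
    have h := card_mul_le_of_le_deg G Lᶜ (D := c) fun v hv => by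
      simp only [L, Finset.mem_compl, Finset.mem_filter, Finset.mem_univ, true_and, not_le] at hv
      exact hv.le
    have h2 : (Lᶜ.card * c) ^ 2 ≤ (2 * m) ^ 2 := pow_le_pow_left₀ (by positivity) h 2
    rw [mul_pow, hc2] at h2
    have : (Lᶜ.card : ℝ) ^ 2 * (48 * m) ≤ (ε * m / 12) * (48 * m) := by
      have := mul_le_mul_of_nonneg_left h2 hε.le
      field_simp at this ⊢
      nlinarith
    exact le_of_mul_le_mul_right this (by positivity)
  have hS : ε * m / 2 ≤ (packingVees T L).card := by
    have h1 := (two_mul_card_le_sum_card_inter hT L).trans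
      (Nat.add_le_add_right (sum_card_inter_le_card_packingVees hT L) _)
    have h1' : 2 * (T.card : ℝ) ≤ (packingVees T L).card + 2 * (Lᶜ.card : ℝ) ^ 2 := by
      exact_mod_cast h1
    linarith
  have hlog : 0 < Real.logb 2 n :=
    Real.logb_pos (by norm_num) (by exact_mod_cast (by omega : 1 < n))
  let S (i : ℕ) := (packingVees T L).filter fun p => p.1 ∈ bucket G (i + 1)
  -- A vertex of positive degree lies in one of at most `log₂ n` buckets.
  have hcover : packingVees T L ⊆ (Finset.range (Nat.log 2 n)).biUnion S := by
    intro p hp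
    have hd := deg_ne_zero_of_isTriangleVee (isTriangleVee_of_mem_packingVees hT hp)
    rw [Finset.mem_biUnion]
    exact ⟨_, Finset.mem_range.2 (log_deg_lt hd), Finset.mem_filter.2 ⟨hp, mem_bucket_log hd⟩⟩
  obtain ⟨i, hi⟩ : ∃ i, ε * m / (2 * Real.logb 2 n) ≤ (S i).card := by
    by_contra! hlt
    have h1 : ε * m / 2 ≤ ∑ i ∈ Finset.range (Nat.log 2 n), ((S i).card : ℝ) := by
      refine hS.trans ?_
      exact_mod_cast (Finset.card_le_card hcover).trans Finset.card_biUnion_le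
    have hne : (Finset.range (Nat.log 2 n)).Nonempty := by
      by_contra hemp
      rw [Finset.not_nonempty_iff_eq_empty.1 hemp, Finset.sum_empty] at h1
      have : 0 < ε * m / 2 := by positivity
      linarith
    have h2 := Finset.sum_lt_sum_of_nonempty hne fun i _ => hlt i
    rw [Finset.sum_const, Finset.card_range, nsmul_eq_mul] at h2
    have h3 : (Nat.log 2 n : ℝ) * (ε * m / (2 * Real.logb 2 n)) ≤
        Real.logb 2 n * (ε * m / (2 * Real.logb 2 n)) := by
      gcongr
      exact natLog_le_logb n
    have h4 : Real.logb 2 n * (ε * m / (2 * Real.logb 2 n)) = ε * m / 2 := by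
      field_simp
    linarith
  refine ⟨i, ⟨S i, fun p hp => ?_, fun p hp q hq => ?_, hi⟩, ?_⟩
  · obtain ⟨hp, hb⟩ := Finset.mem_filter.1 hp
    exact ⟨isTriangleVee_of_mem_packingVees hT hp, hb⟩
  · exact disjointVees_packingVees hT L p (Finset.mem_filter.1 hp).1 q (Finset.mem_filter.1 hq).1
  · have hpos : 0 < ε * m / (2 * Real.logb 2 n) := by positivity
    obtain ⟨p, hp⟩ : (S i).Nonempty := by
      rw [← Finset.card_pos]
      exact_mod_cast hpos.trans_le hi
    obtain ⟨hp, hb⟩ := Finset.mem_filter.1 hp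
    have hL : (deg G p.1 : ℝ) ≤ c := by
      simp only [packingVees, Finset.mem_filter, L, Finset.mem_univ, true_and] at hp
      exact hp.1
    refine le_trans ?_ hL
    exact_mod_cast hb.1

theorem exists_isMinFullBucket {ε : ℝ} (hε : 0 < ε) {G : SimpleGraph (Fin n)} (hn : 2 ≤ n)
    (hm : 0 < numEdges G) (hG : IsFar TriangleFree ε G) :
    ∃ i, IsMinFullBucket ε G (i + 1) ∧ (3 : ℝ) ^ i ≤ √(48 / ε) * √(numEdges G) := by
  classical
  obtain ⟨i, hi, hle⟩ := exists_isFullBucket hε hn hm hG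
  have hex : ∃ i, IsFullBucket ε G i := ⟨_, hi⟩
  have hlog : 0 < Real.logb 2 n :=
    Real.logb_pos (by norm_num) (by exact_mod_cast (by omega : 1 < n))
  have hne : Nat.find hex ≠ 0 := by
    intro h0
    obtain ⟨S, hS, -, hc⟩ := Nat.find_spec hex
    have hpos : 0 < ε * (numEdges G : ℝ) / (2 * Real.logb 2 n) := by positivity
    obtain ⟨p, hp⟩ : S.Nonempty := by
      rw [← Finset.card_pos]
      exact_mod_cast hpos.trans_le hc
    obtain ⟨h1, h2⟩ := hS p hp
    rw [h0] at h2
    exact deg_ne_zero_of_isTriangleVee h1 h2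
  obtain ⟨j, hj⟩ := Nat.exists_eq_succ_of_ne_zero hne
  refine ⟨j, ⟨?_, fun l hl => ?_⟩, ?_⟩
  · have := Nat.find_spec hex
    rwa [hj] at this
  · have := Nat.find_min' hex hl
    rwa [hj] at this
  · have h1 : j ≤ i := by
      have := Nat.find_min' hex hi
      omega
    exact (pow_le_pow_right₀ (by norm_num) h1).trans hle

/-- A vertex is `θ`-rich if it is the source of at least `θ` disjoint triangle-vees, given here by
the two end points `u i` and `w i` of each of them. -/
def IsRich (G : SimpleGraph (Fin n)) (θ : ℝ) (v : Fin n) : Prop :=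
  ∃ (I : Finset (Sym2 (Fin n))) (u w : Sym2 (Fin n) → Fin n), Set.InjOn u I ∧ Set.InjOn w I ∧
    θ ≤ I.card ∧ ∀ e ∈ I, G.Adj v (u e) ∧ G.Adj v (w e) ∧ G.Adj (u e) (w e)

/-- In a full bucket `O(|E| / D)` vertices, each the source of at most `3 * D` disjoint
triangle-vees, share `Ω(|E| / log n)` such vees, so `Ω(|E| / (D log n))` of the vertices are the
source of `Ω(D / log n)` of them. -/
theorem exists_isRich {ε : ℝ} (hε : 0 < ε) {G : SimpleGraph (Fin n)} (hn : 2 ≤ n) {i : ℕ}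
    (hi : IsFullBucket ε G (i + 1)) :
    ∃ F : Finset (Fin n), ε * numEdges G / (12 * 3 ^ i * Real.logb 2 n) ≤ F.card ∧
      ∀ v ∈ F, deg G v < 3 ^ (i + 1) ∧ 3 ^ i ≤ deg G v ∧
        IsRich G (ε * 3 ^ i / (8 * Real.logb 2 n)) v := by
  classical
  obtain ⟨S, hS, hdisj, hcard⟩ := hi
  set m : ℝ := (numEdges G : ℝ) with hm
  have hlog : 0 < Real.logb 2 n :=
    Real.logb_pos (by norm_num) (by exact_mod_cast (by omega : 1 < n))
  set lg := Real.logb 2 n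
  set θ : ℝ := ε * 3 ^ i / (8 * lg) with hθ
  let I (v : Fin n) : Finset (Sym2 (Fin n)) := (S.filter fun p => p.1 = v).image Prod.snd
  let u (e : Sym2 (Fin n)) : Fin n := e.out.1
  let w (e : Sym2 (Fin n)) : Fin n := e.out.2
  have hmem (v : Fin n) (e : Sym2 (Fin n)) : e ∈ I v ↔ (v, e) ∈ S := by
    simp [I]
  have hI (v : Fin n) : (I v).card = (S.filter fun p => p.1 = v).card := by
    refine Finset.card_image_of_injOn fun p hp q hq hpq => ?_
    simp only [Finset.coe_filter, Set.mem_ofPred_eq] at hp hq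
    exact Prod.ext (hp.2.trans hq.2.symm) hpq
  have hinj (v : Fin n) (x : Sym2 (Fin n) → Fin n) (hx : ∀ e, x e ∈ e) :
      Set.InjOn x (I v) := by
    intro e he e' he' hee
    rw [Finset.mem_coe, hmem] at he he'
    by_contra hne
    rcases hdisj _ he _ he' (by simp [hne]) with h | h
    · exact h rfl
    · exact Set.disjoint_left.1 h ⟨x e, hx e, rfl⟩ ⟨x e', hx e', by rw [hee]⟩
  have hu (e : Sym2 (Fin n)) : u e ∈ e := Sym2.out_fst_mem e
  have hw (e : Sym2 (Fin n)) : w e ∈ e := Sym2.out_snd_mem e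
  have hadj (v : Fin n) (e : Sym2 (Fin n)) (he : e ∈ I v) (x : Fin n) (hx : x ∈ e) :
      G.Adj v x :=
    (hS _ ((hmem v e).1 he)).1.2 ⟨x, hx, rfl⟩
  have huw (v : Fin n) (e : Sym2 (Fin n)) (he : e ∈ I v) : G.Adj (u e) (w e) := by
    have h : s(u e, w e) = e := e.out_eq
    have := (hS _ ((hmem v e).1 he)).1.1
    rw [← SimpleGraph.mem_edgeSet, h]
    exact this
  have hdeg (v : Fin n) : (I v).card ≤ deg G v := by
    rw [deg_eq_degree, SimpleGraph.degree]
    refine Finset.card_le_card_of_injOn u (fun e he => ?_) (hinj v u hu)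
    simpa using hadj v e he _ (hu e)
  let V : Finset (Fin n) := Finset.univ.filter fun v => v ∈ bucket G (i + 1)
  let F : Finset (Fin n) := V.filter fun v => θ ≤ (I v).card
  have hsum : (S.card : ℝ) = ∑ v ∈ V, ((I v).card : ℝ) := by
    rw [Finset.card_eq_sum_card_fiberwise (f := Prod.fst) (t := V) fun p hp => by
      simpa [V] using (hS p hp).2]
    push_cast
    exact Finset.sum_congr rfl fun v _ => by rw [hI]
  have hsmall : ∑ v ∈ V.filter (fun v => ¬ θ ≤ (I v).card), ((I v).card : ℝ) ≤
      ε * m / (4 * lg) := by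
    have hVcard : (V.card : ℝ) * 3 ^ i ≤ 2 * m := by
      refine card_mul_le_of_le_deg G V fun v hv => ?_
      exact_mod_cast (Finset.mem_filter.1 hv).2.1
    calc ∑ v ∈ V.filter (fun v => ¬ θ ≤ (I v).card), ((I v).card : ℝ)
        ≤ ∑ v ∈ V.filter (fun v => ¬ θ ≤ (I v).card), θ :=
          Finset.sum_le_sum fun v hv => (not_le.1 (Finset.mem_filter.1 hv).2).le
      _ ≤ V.card * θ := by
          rw [Finset.sum_const, nsmul_eq_mul]
          gcongr
          exact Finset.filter_subset _ _
      _ = (V.card * 3 ^ i) * (ε / (8 * lg)) := by rw [hθ]; ring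
      _ ≤ 2 * m * (ε / (8 * lg)) := by gcongr
      _ = ε * m / (4 * lg) := by field_simp; ring
  have hbig : ∑ v ∈ F, ((I v).card : ℝ) ≤ F.card * 3 ^ (i + 1) := by
    rw [← nsmul_eq_mul, ← Finset.sum_const]
    refine Finset.sum_le_sum fun v hv => ?_
    have := (Finset.mem_filter.1 (Finset.mem_filter.1 hv).1).2.2
    exact_mod_cast (hdeg v).trans this.le
  refine ⟨F, ?_, fun v hv => ?_⟩
  · have hsplit := Finset.sum_filter_add_sum_filter_not V (fun v => θ ≤ (I v).card)
      fun v => ((I v).card : ℝ)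
    have h1 : ε * m / (4 * lg) ≤ F.card * 3 ^ (i + 1) := by
      have : ε * m / (2 * lg) = ε * m / (4 * lg) + ε * m / (4 * lg) := by field_simp; ring
      linarith
    have h2 : ε * m / (12 * 3 ^ i * lg) * 3 ^ (i + 1) = ε * m / (4 * lg) := by
      rw [pow_succ]
      field_simp
      ring
    rw [← h2] at h1
    exact le_of_mul_le_mul_right h1 (by positivity)
  · obtain ⟨hv, hvθ⟩ := Finset.mem_filter.1 hv
    have hb := (Finset.mem_filter.1 hv).2
    exact ⟨hb.2, hb.1, I v, u, w, hinj v u hu, hinj v w hw, hvθ, fun e he =>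
      ⟨hadj v e he _ (hu e), hadj v e he _ (hw e), huw v e he⟩⟩

end Graphs

open CoordinatorModel

section Runs

/-! ### The protocol -/

/-- The constants of the protocol. With `D = 3 ^ i` and an estimate `2 ^ t` of the number of edges,
level `i` samples a vertex with probability about `vertexRate * D * log n / 2 ^ t` and an end
point of an edge with probability about `√(neighborRate * log n / D)`; it gives up if more than
`capRate * √D * log n ^ (3/2)` edges are sampled; and the levels are those with
`D ≤ rangeRate * √(2 ^ t)`. -/
structure Rates where
  vertexRate : ℝ
  neighborRate : ℝ
  capRate : ℝ
  rangeRate : ℝ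

variable {n k : ℕ} (c : Rates)

/-- The probability with which level `i` samples a vertex. -/
noncomputable def vertexProb (n t i : ℕ) : ℝ :=
  c.vertexRate * 3 ^ i * Real.logb 2 n / 2 ^ t

/-- The probability with which level `i` samples an end point of an edge. -/
noncomputable def neighborProb (n i : ℕ) : ℝ := √(c.neighborRate * Real.logb 2 n / 3 ^ i)

/-- The number of edges that can be communicated at level `i`. -/
noncomputable def capacity (n i : ℕ) : ℝ :=
  c.capRate * (√(3 ^ i) * (Real.logb 2 n * √(Real.logb 2 n)))

/-- The shared random bits by which edges are sampled: a value for each vertex in the role of a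
source, and two values in the role of an end point of an edge, so that the two end points of a vee
are sampled independently. -/
abbrev Samples (n : ℕ) : Type :=
  (Fin n → Fin (n ^ 2)) × ((Fin n → Fin (n ^ 2)) × (Fin n → Fin (n ^ 2)))

/-- The shared randomness: a value for each pair of vertices, by which the number of edges is
estimated, and the values by which edges are sampled. -/
abbrev Coins (n : ℕ) : Type := (Sym2 (Fin n) → Fin (n ^ 2)) × Samples n

/-- Level `i` samples the vertex `v` as a source. -/
def IsSource (t i : ℕ) (f : Fin n → Fin (n ^ 2)) (v : Fin n) : Prop :=
  (f v : ℕ) < ⌈vertexProb c n t i * (n ^ 2 : ℕ)⌉₊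

/-- Level `i` samples the vertex `u` as an end point. -/
def IsEndpoint (i : ℕ) (g : Fin n → Fin (n ^ 2)) (u : Fin n) : Prop :=
  (g u : ℕ) < ⌈neighborProb c n i * (n ^ 2 : ℕ)⌉₊

open Classical in
/-- The oriented edges `(v, u)` of `H` that are sampled at level `i`. -/
noncomputable def sample (t i : ℕ) (ω : Samples n) (H : SimpleGraph (Fin n)) :
    Finset (Fin n × Fin n) :=
  Finset.univ.filter fun p => H.Adj p.1 p.2 ∧ IsSource c t i ω.1 p.1 ∧
    (IsEndpoint c i ω.2.1 p.2 ∨ IsEndpoint c i ω.2.2 p.2)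

open Classical in
/-- The set `U` if it has at most `a` elements, and the empty set otherwise. -/
noncomputable def truncate {α : Type} (a : ℝ) (U : Finset α) : Finset α :=
  if (U.card : ℝ) ≤ a then U else ∅

theorem truncate_subset {α : Type} (a : ℝ) (U : Finset α) : truncate a U ⊆ U := by
  rw [truncate]
  split_ifs <;> simp

theorem card_truncate_le {α : Type} {a : ℝ} (ha : 0 ≤ a) (U : Finset α) :
    ((truncate a U).card : ℝ) ≤ a := by
  rw [truncate]
  split_ifs with h
  · exact h
  · simpa using ha

theorem truncate_eq {α : Type} {a : ℝ} {U : Finset α} (h : (U.card : ℝ) ≤ a) :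
    truncate a U = U := if_pos h

open Classical in
/-- Two edges `(v, u)` and `(v, w)` of `U` that form a triangle together with an edge of `H`, or the
empty set if there are none. -/
noncomputable def closing (H : SimpleGraph (Fin n)) (U : Finset (Fin n × Fin n)) :
    Finset (Fin n × Fin n) :=
  if h : ∃ q : Fin n × Fin n × Fin n, (q.1, q.2.1) ∈ U ∧ (q.1, q.2.2) ∈ U ∧ H.Adj q.2.1 q.2.2 then
    {(h.choose.1, h.choose.2.1), (h.choose.1, h.choose.2.2)}
  else ∅

/-- The end points of a set of edges. -/
def endpoints (W : Finset (Fin n × Fin n)) : Finset (Fin n) := W.image Prod.fst ∪ W.image Prod.snd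

theorem card_closing_le (H : SimpleGraph (Fin n)) (U : Finset (Fin n × Fin n)) :
    (closing H U).card ≤ 2 := by
  rw [closing]
  split_ifs
  · exact Finset.card_le_two
  · simp

theorem isNClique_endpoints_closing {G H : SimpleGraph (Fin n)} {U : Finset (Fin n × Fin n)}
    (hU : ∀ p ∈ U, G.Adj p.1 p.2) (hH : H ≤ G) (h : closing H U ≠ ∅) :
    G.IsNClique 3 (endpoints (closing H U)) := by
  rw [closing] at h ⊢
  split_ifs at h ⊢ with hq
  · have h1 := hU _ hq.choose_spec.1
    have h2 := hU _ hq.choose_spec.2.1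
    have h3 := hH hq.choose_spec.2.2
    have : endpoints {(hq.choose.1, hq.choose.2.1), (hq.choose.1, hq.choose.2.2)} =
        {hq.choose.1, hq.choose.2.1, hq.choose.2.2} := by
      ext x
      simp [endpoints, or_left_comm]
    rw [this]
    exact SimpleGraph.is3Clique_triple_iff.2 ⟨h1, h2, h3⟩
  · exact absurd rfl h

theorem closing_ne_empty {H : SimpleGraph (Fin n)} {U : Finset (Fin n × Fin n)} {v u w : Fin n}
    (h1 : (v, u) ∈ U) (h2 : (v, w) ∈ U) (h3 : H.Adj u w) : closing H U ≠ ∅ := by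
  rw [closing, dif_pos ⟨(v, u, w), h1, h2, h3⟩]
  simp

open Classical in
/-- The level of an edge with random value `x` is about `log₂ (n ^ 2 / x)`; the greatest level of an
edge of `H` estimates the logarithm of the number of edges. -/
noncomputable def edgeLevel (h : Sym2 (Fin n) → Fin (n ^ 2)) (H : SimpleGraph (Fin n)) : ℕ :=
  (Finset.univ.filter fun e => e ∈ H.edgeSet).sup fun e => Nat.log 2 (n ^ 2 / (h e + 1))

/-! ### Encoding of the messages -/

/-- A number of bits that is sufficient for a pair of vertices. -/
def pairBits (n : ℕ) : ℕ := Nat.clog 2 (n * n) + 1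

theorem exists_encodeSet (n : ℕ) : ∃ enc : Finset (Fin n × Fin n) → Message,
    enc.Injective ∧ ∀ U, (enc U).size = pairBits n * U.card + 1 := by
  refine exists_finset_encoding _ (Nat.succ_ne_zero _) ?_
  rw [Fintype.card_prod, Fintype.card_fin]
  exact (Nat.le_pow_clog (by norm_num) _).trans (Nat.pow_le_pow_right two_pos (Nat.le_succ _))

/-- The encoding of a set of pairs of vertices. -/
noncomputable def encodeSet (U : Finset (Fin n × Fin n)) : Message :=
  (exists_encodeSet n).choose U

theorem encodeSet_injective : Function.Injective (encodeSet (n := n)) :=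
  (exists_encodeSet n).choose_spec.1

theorem size_encodeSet (U : Finset (Fin n × Fin n)) :
    (encodeSet U).size = pairBits n * U.card + 1 :=
  (exists_encodeSet n).choose_spec.2 U

/-- The inverse of `encodeSet`. -/
noncomputable def decodeSet : Message → Finset (Fin n × Fin n) := Function.invFun encodeSet

@[simp] theorem decodeSet_encodeSet (U : Finset (Fin n × Fin n)) :
    decodeSet (encodeSet U) = U :=
  Function.leftInverse_invFun encodeSet_injective U

/-- The questions that the coordinator asks: for the greatest level of an edge, for the edges
sampled at a level, and for an edge that completes two edges of `U` to a triangle. -/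
inductive Question (n : ℕ) : Type
  | estimate : Question n
  | collect (t i : ℕ) : Question n
  | close (U : Finset (Fin n × Fin n)) : Question n

/-- The encoding of a question. -/
noncomputable def Question.encode : Question n → Message
  | estimate => ⟨[true], by simp⟩
  | collect t i => ⟨true :: true :: (List.replicate t true ++ false :: List.replicate i true),
      by simp⟩
  | close U => ⟨false :: (encodeSet U).1, by simp⟩

theorem replicate_append_cons_injective {t t' : ℕ} {l l' : List Bool}
    (h : List.replicate t true ++ false :: l = List.replicate t' true ++ false :: l') :
    t = t' ∧ l = l' := by
  induction t generalizing t' with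
  | zero => cases t' <;> simp_all [List.replicate_succ]
  | succ t ih =>
    cases t' with
    | zero => simp [List.replicate_succ] at h
    | succ t' =>
      rw [List.replicate_succ, List.replicate_succ, List.cons_append, List.cons_append,
        List.cons.injEq] at h
      obtain ⟨rfl, h2⟩ := ih h.2
      exact ⟨rfl, h2⟩

theorem Question.encode_injective : Function.Injective (Question.encode (n := n)) := by
  intro p q h
  have h := congrArg Subtype.val h
  cases p <;> cases q <;> simp only [Question.encode] at h
  case estimate.estimate => rfl
  case collect.collect t i t' i' =>
    simp only [List.cons.injEq, true_and] at h
    obtain ⟨rfl, h2⟩ := replicate_append_cons_injective h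
    have := congrArg List.length h2
    simp only [List.length_replicate] at this
    rw [this]
  case close.close U U' =>
    simp only [List.cons.injEq, true_and] at h
    rw [encodeSet_injective (Subtype.ext h)]
  all_goals simp at h

instance : Nonempty (Question n) := ⟨.estimate⟩

/-- The inverse of `Question.encode`. -/
noncomputable def Question.decode : Message → Question n := Function.invFun Question.encode

@[simp] theorem Question.decode_encode (q : Question n) : decode (encode q) = q :=
  Function.leftInverse_invFun Question.encode_injective q

/-- The reply of a player who holds the edges of `H`. -/
noncomputable def reply (ω : Coins n) (H : SimpleGraph (Fin n)) (m : Message) : Message :=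
  match Question.decode (n := n) m with
  | .estimate => unary (edgeLevel ω.1 H)
  | .collect t i => encodeSet (truncate (capacity c n i) (sample c t i ω.2 H))
  | .close U => encodeSet (closing H U)

open Classical in
/-- The union of the sets that are encoded by a list of messages. -/
noncomputable def gather (as : List Message) : Finset (Fin n × Fin n) :=
  Finset.univ.filter fun p => ∃ a ∈ as, p ∈ decodeSet a

open Classical in
/-- The coordinator goes through a list of levels until a triangle is found. -/
noncomputable def scan (n k t : ℕ) : List ℕ → Coordinator k (Option (Finset (Fin n)))
  | [] => .output none
  | i :: is =>
      .askAll (Question.collect (n := n) t i).encode fun as =>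
        .askAll (Question.close (n := n) (truncate (capacity c n i) (gather as))).encode fun bs =>
          match (bs.map (decodeSet (n := n))).find? (fun W => W ≠ ∅) with
          | some W => .output (some (endpoints W))
          | none => scan n k t is

/-- The levels that are scanned if the number of edges is estimated to be `2 ^ t`. -/
noncomputable def levels (t : ℕ) : List ℕ :=
  List.range (Nat.log 3 ⌊c.rangeRate * √(2 ^ t)⌋₊ + 1)

/-- The coordinator that knows that there are about `2 ^ t` edges. -/
noncomputable def knownCoordinator (n k t : ℕ) : Coordinator k (Option (Finset (Fin n))) :=
  scan c n k t (levels c t)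

/-- The coordinator that first estimates the number of edges. -/
noncomputable def unknownCoordinator (n k : ℕ) : Coordinator k (Option (Finset (Fin n))) :=
  .askAll (Question.estimate (n := n)).encode fun as =>
    knownCoordinator c n k (as.toFinset.sup fun a => a.size - 1)

/-! ### One level of the protocol -/

variable (X : Fin k → SimpleGraph (Fin n)) (ω : Coins n)

open Classical in
/-- The edges that the coordinator receives at level `i`. -/
noncomputable def collected (t i : ℕ) : Finset (Fin n × Fin n) :=
  Finset.univ.filter fun p => ∃ j, p ∈ truncate (capacity c n i) (sample c t i ω.2 (X j))

open Classical in
/-- The first nonempty reply of a player who completes two edges to a triangle at level `i`. -/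
noncomputable def levelResult (t i : ℕ) : Option (Finset (Fin n × Fin n)) :=
  ((List.finRange k).map fun j =>
    closing (X j) (truncate (capacity c n i) (collected c X ω t i))).find? fun W => W ≠ ∅

/-- An upper bound for the number of bits that are exchanged at level `i`. -/
noncomputable def levelCost (n k t i : ℕ) : ℝ :=
  k * (t + i + 2 * pairBits n * capacity c n i + 2 * pairBits n + 7)

theorem gather_reply (t i : ℕ) :
    gather ((List.finRange k).map fun j =>
      reply c ω (X j) (Question.collect (n := n) t i).encode) = collected c X ω t i := by
  ext p
  simp [gather, collected, reply]

theorem map_decodeSet_reply (U : Finset (Fin n × Fin n)) :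
    ((List.finRange k).map fun j => reply c ω (X j) (Question.close U).encode).map
      (decodeSet (n := n)) = (List.finRange k).map fun j => closing (X j) U := by
  simp [reply]

theorem scan_cons_fst (t i : ℕ) (is : List ℕ) :
    ((scan c n k t (i :: is)).eval fun j => reply c ω (X j)).1 =
      match levelResult c X ω t i with
      | some W => some (endpoints W)
      | none => ((scan c n k t is).eval fun j => reply c ω (X j)).1 := by
  rw [scan, Coordinator.eval_askAll_fst, Coordinator.eval_askAll_fst, gather_reply]
  rw [map_decodeSet_reply, levelResult]
  split <;> simp_all [Coordinator.eval]

theorem scan_cons_snd_le (hc : 0 ≤ c.capRate) (hn : 1 ≤ n) (t i : ℕ) (is : List ℕ) :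
    (((scan c n k t (i :: is)).eval fun j => reply c ω (X j)).2 : ℝ) ≤
      levelCost c n k t i +
        match levelResult c X ω t i with
        | some _ => 0
        | none => (((scan c n k t is).eval fun j => reply c ω (X j)).2 : ℝ) := by
  have hlog : 0 ≤ Real.logb 2 n := Real.logb_nonneg (by norm_num) (by exact_mod_cast hn)
  have hcap : 0 ≤ capacity c n i := by
    rw [capacity]
    positivity
  have hset (U : Finset (Fin n × Fin n)) {a : ℝ} (h : (U.card : ℝ) ≤ a) :
      ((encodeSet U).size : ℝ) ≤ pairBits n * a + 1 := by
    rw [size_encodeSet]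
    push_cast
    gcongr
  have h1 (j : Fin k) : ((reply c ω (X j) (Question.collect (n := n) t i).encode).size : ℝ) ≤
      pairBits n * capacity c n i + 1 := by
    simp only [reply, Question.decode_encode]
    exact hset _ (card_truncate_le hcap _)
  have h2 (U : Finset (Fin n × Fin n)) (j : Fin k) :
      ((reply c ω (X j) (Question.close U).encode).size : ℝ) ≤ pairBits n * 2 + 1 := by
    simp only [reply, Question.decode_encode]
    exact hset _ (by exact_mod_cast card_closing_le _ _)
  have h3 : ((Question.collect (n := n) t i).encode.size : ℝ) = t + i + 3 := by
    simp only [Question.encode, Message.size, List.length_cons, List.length_append,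
      List.length_replicate]
    push_cast
    ring
  have h4 : ((Question.close (truncate (capacity c n i) (collected c X ω t i))).encode.size : ℝ) ≤
      pairBits n * capacity c n i + 2 := by
    have := hset _ (card_truncate_le hcap (collected c X ω t i))
    simp only [Question.encode, Message.size, List.length_cons] at this ⊢
    push_cast
    linarith
  rw [scan]
  refine (Coordinator.eval_askAll_snd_le _ _ _ h1).trans ?_
  rw [gather_reply]
  refine (add_le_add_right (Coordinator.eval_askAll_snd_le _ _ _ (h2 _)) _).trans ?_
  rw [map_decodeSet_reply, ← add_assoc]
  refine add_le_add ?_ ?_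
  · rw [levelCost, h3]
    have : (0 : ℝ) ≤ k := Nat.cast_nonneg k
    nlinarith
  · rw [levelResult]
    split <;> simp_all [Coordinator.eval]

theorem mem_sample {t i : ℕ} {ω : Samples n} {H : SimpleGraph (Fin n)} {p : Fin n × Fin n} :
    p ∈ sample c t i ω H ↔ H.Adj p.1 p.2 ∧ IsSource c t i ω.1 p.1 ∧
      (IsEndpoint c i ω.2.1 p.2 ∨ IsEndpoint c i ω.2.2 p.2) := by
  simp [sample]

theorem inputGraph_adj {X : Fin k → SimpleGraph (Fin n)} {u v : Fin n} :
    (inputGraph X).Adj u v ↔ ∃ j, (X j).Adj u v := by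
  simp [inputGraph]

theorem le_inputGraph (X : Fin k → SimpleGraph (Fin n)) (j : Fin k) : X j ≤ inputGraph X :=
  le_iSup X j

theorem collected_subset (t i : ℕ) :
    collected c X ω t i ⊆ sample c t i ω.2 (inputGraph X) := by
  intro p hp
  simp only [collected, Finset.mem_filter, Finset.mem_univ, true_and] at hp
  obtain ⟨j, hj⟩ := hp
  have := (mem_sample c).1 (truncate_subset _ _ hj)
  exact (mem_sample c).2 ⟨le_inputGraph X j this.1, this.2⟩

theorem collected_eq {t i : ℕ}
    (h : ((sample c t i ω.2 (inputGraph X)).card : ℝ) ≤ capacity c n i) :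
    collected c X ω t i = sample c t i ω.2 (inputGraph X) := by
  refine (collected_subset c X ω t i).antisymm fun p hp => ?_
  obtain ⟨h1, h2⟩ := (mem_sample c).1 hp
  obtain ⟨j, hj⟩ := inputGraph_adj.1 h1
  simp only [collected, Finset.mem_filter, Finset.mem_univ, true_and]
  refine ⟨j, ?_⟩
  rw [truncate_eq]
  · exact (mem_sample c).2 ⟨hj, h2⟩
  · refine le_trans ?_ h
    gcongr
    intro q hq
    have := (mem_sample c).1 hq
    exact (mem_sample c).2 ⟨le_inputGraph X j this.1, this.2⟩

theorem isNClique_of_levelResult {t i : ℕ} {W : Finset (Fin n × Fin n)}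
    (h : levelResult c X ω t i = some W) : (inputGraph X).IsNClique 3 (endpoints W) := by
  have h1 := List.mem_of_find?_eq_some h
  have h2 := List.find?_some h
  obtain ⟨j, -, rfl⟩ := List.mem_map.1 h1
  refine isNClique_endpoints_closing (fun p hp => ?_) (le_inputGraph X j) (by simpa using h2)
  exact ((mem_sample c).1 (collected_subset c X ω t i (truncate_subset _ _ hp))).1

/-- Level `i` succeeds: both edges of a triangle-vee are sampled, and the number of sampled edges
does not exceed the capacity. -/
def LevelSucceeds (G : SimpleGraph (Fin n)) (t i : ℕ) (ω : Samples n) : Prop :=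
  ((sample c t i ω G).card : ℝ) ≤ capacity c n i ∧
    ∃ v u w, (v, u) ∈ sample c t i ω G ∧ (v, w) ∈ sample c t i ω G ∧ G.Adj u w

theorem levelResult_ne_none {t i : ℕ} (h : LevelSucceeds c (inputGraph X) t i ω.2) :
    levelResult c X ω t i ≠ none := by
  obtain ⟨hcap, v, u, w, h1, h2, h3⟩ := h
  obtain ⟨j, hj⟩ := inputGraph_adj.1 h3
  rw [levelResult, collected_eq c X ω hcap, truncate_eq hcap]
  intro hnone
  rw [List.find?_eq_none] at hnone
  have := hnone _ (List.mem_map.2 ⟨j, List.mem_finRange j, rfl⟩)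
  simp only [ne_eq, decide_not, Bool.not_eq_true', decide_eq_false_iff_not, not_not] at this
  exact closing_ne_empty h1 h2 hj this

/-! ### Runs of the protocol -/

theorem isNClique_of_scan {t : ℕ} {is : List ℕ} {s : Finset (Fin n)}
    (h : ((scan c n k t is).eval fun j => reply c ω (X j)).1 = some s) :
    (inputGraph X).IsNClique 3 s := by
  induction is with
  | nil => simp [scan, Coordinator.eval] at h
  | cons i is ih =>
    rw [scan_cons_fst] at h
    cases hr : levelResult c X ω t i with
    | none =>
      rw [hr] at h
      exact ih h
    | some W =>
      rw [hr] at h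
      cases h
      exact isNClique_of_levelResult c X ω hr

theorem scan_snd_le (hc : 0 ≤ c.capRate) (hn : 1 ≤ n) (t : ℕ) (is : List ℕ) :
    (((scan c n k t is).eval fun j => reply c ω (X j)).2 : ℝ) ≤
      (is.map (levelCost c n k t)).sum := by
  induction is with
  | nil => simp [scan, Coordinator.eval]
  | cons i is ih =>
    refine (scan_cons_snd_le c X ω hc hn t i is).trans ?_
    rw [List.map_cons, List.sum_cons]
    gcongr
    cases levelResult c X ω t i with
    | none => exact ih
    | some W => exact (Nat.cast_nonneg _).trans ih

theorem scan_of_succeeds (hc : 0 ≤ c.capRate) (hn : 1 ≤ n) {t i : ℕ} (pre post : List ℕ)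
    (h : LevelSucceeds c (inputGraph X) t i ω.2) :
    ((scan c n k t (pre ++ i :: post)).eval fun j => reply c ω (X j)).1 ≠ none ∧
    (((scan c n k t (pre ++ i :: post)).eval fun j => reply c ω (X j)).2 : ℝ) ≤
      ((pre ++ [i]).map (levelCost c n k t)).sum := by
  induction pre with
  | nil =>
    obtain ⟨W, hW⟩ := Option.ne_none_iff_exists'.1 (levelResult_ne_none c X ω h)
    have h1 := scan_cons_fst c X ω t i post
    have h2 := scan_cons_snd_le c X ω hc hn t i post
    rw [hW] at h1 h2
    refine ⟨by simp [h1], by simpa using h2⟩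
  | cons a pre ih =>
    have h1 := scan_cons_fst c X ω t a (pre ++ i :: post)
    have h2 := scan_cons_snd_le c X ω hc hn t a (pre ++ i :: post)
    have hsum : 0 ≤ ((pre ++ [i]).map (levelCost c n k t)).sum :=
      (Nat.cast_nonneg _).trans ih.2
    rw [List.cons_append, List.cons_append, List.map_cons, List.sum_cons]
    cases hr : levelResult c X ω t a with
    | none =>
      rw [hr] at h1 h2
      exact ⟨by rw [h1]; exact ih.1, h2.trans (add_le_add_right ih.2 _)⟩
    | some W =>
      rw [hr] at h1 h2
      exact ⟨by simp [h1], h2.trans (add_le_add_right hsum _)⟩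

theorem mem_levels {t i : ℕ} (h : (3 : ℝ) ^ i ≤ c.rangeRate * √(2 ^ t)) : i ∈ levels c t := by
  rw [levels, List.mem_range, Nat.lt_succ_iff]
  have h1 : 3 ^ i ≤ ⌊c.rangeRate * √(2 ^ t)⌋₊ := Nat.le_floor (by exact_mod_cast h)
  exact Nat.le_log_of_pow_le (by norm_num) h1

theorem le_of_mem_levels {t i : ℕ} (hc : 1 ≤ c.rangeRate) (h : i ∈ levels c t) :
    (3 : ℝ) ^ i ≤ c.rangeRate * √(2 ^ t) := by
  rw [levels, List.mem_range, Nat.lt_succ_iff] at h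
  have h2 : 1 ≤ c.rangeRate * √(2 ^ t) := by
    have : 1 ≤ √((2 : ℝ) ^ t) := Real.one_le_sqrt.2 (one_le_pow₀ (by norm_num))
    nlinarith
  have h0 : ⌊c.rangeRate * √(2 ^ t)⌋₊ ≠ 0 := by
    rw [ne_eq, Nat.floor_eq_zero, not_lt]
    exact h2
  have h1 := Nat.pow_le_of_le_log h0 h
  calc (3 : ℝ) ^ i = ((3 ^ i : ℕ) : ℝ) := by push_cast; rfl
    _ ≤ (⌊c.rangeRate * √(2 ^ t)⌋₊ : ℝ) := by exact_mod_cast h1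
    _ ≤ _ := Nat.floor_le (by linarith)

theorem exists_levels_eq {t i : ℕ} (h : i ∈ levels c t) :
    ∃ post, levels c t = List.range i ++ i :: post := by
  rw [levels] at h ⊢
  obtain ⟨r, hr⟩ := Nat.exists_eq_add_of_lt (List.mem_range.1 h)
  refine ⟨(List.range r).map (i + 1 + ·), ?_⟩
  rw [hr, show i + r + 1 = (i + 1) + r by ring, List.range_add, List.range_succ]
  simp

theorem sum_map_range (f : ℕ → ℝ) (i : ℕ) :
    ((List.range i).map f).sum = ∑ j ∈ Finset.range i, f j := by
  induction i with
  | zero => simp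
  | succ i ih => rw [List.range_succ, Finset.sum_range_succ]; simp [ih]

theorem edgeLevel_inputGraph (h : Sym2 (Fin n) → Fin (n ^ 2)) :
    (Finset.univ.sup fun j => edgeLevel h (X j)) = edgeLevel h (inputGraph X) := by
  classical
  apply le_antisymm
  · refine Finset.sup_le fun j _ => Finset.sup_mono fun e he => ?_
    simp only [Finset.mem_filter, Finset.mem_univ, true_and] at he ⊢
    exact SimpleGraph.edgeSet_mono (le_inputGraph X j) he
  · refine Finset.sup_le fun e he => ?_
    simp only [Finset.mem_filter, Finset.mem_univ, true_and] at he
    induction e using Sym2.ind with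
    | _ a b =>
      obtain ⟨j, hj⟩ := inputGraph_adj.1 he
      refine le_trans ?_ (Finset.le_sup (f := fun j => edgeLevel h (X j)) (Finset.mem_univ j))
      exact Finset.le_sup (f := fun e => Nat.log 2 (n ^ 2 / (h e + 1))) (by simpa using hj)

theorem sup_reply_estimate :
    (((List.finRange k).map fun j =>
      reply c ω (X j) (Question.estimate (n := n)).encode).toFinset.sup
        fun a => a.size - 1) = edgeLevel ω.1 (inputGraph X) := by
  rw [← edgeLevel_inputGraph]
  have h (j : Fin k) :
      (reply c ω (X j) (Question.estimate (n := n)).encode).size - 1 = edgeLevel ω.1 (X j) := by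
    simp [reply]
  refine le_antisymm (Finset.sup_le fun a ha => ?_) (Finset.sup_le fun j _ => ?_)
  · obtain ⟨j, -, rfl⟩ := List.mem_map.1 (List.mem_toFinset.1 ha)
    rw [h]
    exact Finset.le_sup (f := fun j => edgeLevel ω.1 (X j)) (Finset.mem_univ j)
  · rw [← h]
    exact Finset.le_sup (f := fun a : Message => a.size - 1)
      (List.mem_toFinset.2 (List.mem_map.2 ⟨j, List.mem_finRange j, rfl⟩))

theorem unknownCoordinator_eval_fst :
    ((unknownCoordinator c n k).eval fun j => reply c ω (X j)).1 =
      ((knownCoordinator c n k (edgeLevel ω.1 (inputGraph X))).eval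
        fun j => reply c ω (X j)).1 := by
  rw [unknownCoordinator, Coordinator.eval_askAll_fst, sup_reply_estimate]

theorem edgeLevel_le (h : Sym2 (Fin n) → Fin (n ^ 2)) (H : SimpleGraph (Fin n)) :
    edgeLevel h H ≤ Nat.log 2 (n ^ 2) :=
  Finset.sup_le fun _ _ => Nat.log_mono_right (Nat.div_le_self _ _)

theorem unknownCoordinator_eval_snd_le :
    (((unknownCoordinator c n k).eval fun j => reply c ω (X j)).2 : ℝ) ≤
      k * (Nat.log 2 (n ^ 2) + 2) +
      ((knownCoordinator c n k (edgeLevel ω.1 (inputGraph X))).eval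
        fun j => reply c ω (X j)).2 := by
  have h (j : Fin k) : ((reply c ω (X j) (Question.estimate (n := n)).encode).size : ℝ) ≤
      Nat.log 2 (n ^ 2) + 1 := by
    simp only [reply, Question.decode_encode, size_unary]
    push_cast
    gcongr
    exact edgeLevel_le _ _
  refine (Coordinator.eval_askAll_snd_le _ _ _ h).trans ?_
  rw [sup_reply_estimate]
  have : ((Question.estimate (n := n)).encode.size : ℝ) = 1 := by
    simp [Question.encode, Message.size]
  rw [this]
  refine add_le_add_left (mul_le_mul_of_nonneg_left ?_ (Nat.cast_nonneg k)) _
  linarith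

end Runs

section Analysis

variable {n k : ℕ} (c : Rates)

/-! ### The cost of the protocol -/

theorem one_le_logb {n : ℕ} (hn : 2 ≤ n) : 1 ≤ Real.logb 2 n := by
  rw [Real.le_logb_iff_rpow_le (by norm_num) (by exact_mod_cast (by omega : 0 < n))]
  simpa using (by exact_mod_cast hn : (2 : ℝ) ≤ n)

theorem natLog_sq_le (n : ℕ) : (Nat.log 2 (n ^ 2) : ℝ) ≤ 2 * Real.logb 2 n := by
  refine (natLog_le_logb _).trans_eq ?_
  rw [Nat.cast_pow, Real.logb_pow]
  norm_num

theorem pairBits_le (hn : 2 ≤ n) : (pairBits n : ℝ) ≤ 4 * Real.logb 2 n := by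
  have h1 : Nat.clog 2 (n * n) ≤ Nat.log 2 (n ^ 2) + 1 := by
    rw [← sq]
    exact Nat.clog_le_of_le_pow (Nat.lt_pow_succ_log_self (by norm_num) _).le
  have h2 := natLog_sq_le n
  have h3 := one_le_logb hn
  have h4 : (Nat.clog 2 (n * n) : ℝ) ≤ Nat.log 2 (n ^ 2) + 1 := by exact_mod_cast h1
  rw [pairBits]
  push_cast
  linarith

theorem sqrt_pow_succ (i : ℕ) : √((3 : ℝ) ^ (i + 1)) = √3 * √(3 ^ i) := by
  rw [pow_succ', Real.sqrt_mul (by norm_num)]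

theorem one_le_sqrt_pow (i : ℕ) : 1 ≤ √((3 : ℝ) ^ i) :=
  Real.one_le_sqrt.2 (one_le_pow₀ (by norm_num))

theorem le_two_mul_sqrt_pow (i : ℕ) : (i : ℝ) ≤ 2 * √(3 ^ i) := by
  induction i with
  | zero => simp
  | succ i ih =>
    have h1 : (3 / 2 : ℝ) ≤ √3 := Real.le_sqrt_of_sq_le (by norm_num)
    have h2 := one_le_sqrt_pow i
    rw [sqrt_pow_succ]
    push_cast
    nlinarith

theorem sum_sqrt_pow_le (i : ℕ) : ∑ j ∈ Finset.range (i + 1), √((3 : ℝ) ^ j) ≤ 3 * √(3 ^ i) := by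
  induction i with
  | zero => norm_num
  | succ i ih =>
    have h1 : (3 / 2 : ℝ) ≤ √3 := Real.le_sqrt_of_sq_le (by norm_num)
    have h2 := one_le_sqrt_pow i
    rw [Finset.sum_range_succ, sqrt_pow_succ]
    nlinarith

/-- The power `log n ^ (5/2)`. -/
noncomputable def logFactor (n : ℕ) : ℝ := Real.logb 2 n ^ 2 * √(Real.logb 2 n)

theorem logFactor_eq (hn : 2 ≤ n) : logFactor n = Real.logb 2 n ^ (5 / 2 : ℝ) := by
  have h := one_le_logb hn
  rw [logFactor, Real.sqrt_eq_rpow, ← Real.rpow_natCast, ← Real.rpow_add (by linarith)]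
  norm_num

theorem logb_le_logFactor (hn : 2 ≤ n) : Real.logb 2 n ≤ logFactor n := by
  have h := one_le_logb hn
  have h2 := Real.one_le_sqrt.2 h
  rw [logFactor]
  nlinarith [mul_le_mul h h2 (by norm_num) (by linarith)]

/-- The cost of level `i`, as a multiple of `k * √(3 ^ i) * log n ^ (5/2)`. -/
def costRate : ℝ := 19 + 8 * c.capRate

theorem levelCost_le (hc : 0 ≤ c.capRate) (hn : 2 ≤ n) {t : ℕ} (ht : t ≤ Nat.log 2 (n ^ 2))
    (i : ℕ) : levelCost c n k t i ≤ costRate c * k * √(3 ^ i) * logFactor n := by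
  have h1 : (t : ℝ) ≤ 2 * Real.logb 2 n :=
    le_trans (by exact_mod_cast ht) (natLog_sq_le n)
  have h2 := pairBits_le hn
  have h3 := one_le_logb hn
  have h4 := one_le_sqrt_pow i
  have h5 := le_two_mul_sqrt_pow i
  have h6 := logb_le_logFactor hn
  have h7 : 0 ≤ capacity c n i := by
    rw [capacity]
    positivity
  set s := √((3 : ℝ) ^ i)
  set l := Real.logb 2 n
  have h8 : pairBits n * capacity c n i ≤ 4 * c.capRate * (s * logFactor n) := by
    calc pairBits n * capacity c n i ≤ 4 * l * capacity c n i := by gcongr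
      _ = 4 * c.capRate * (s * logFactor n) := by
        rw [capacity, logFactor]
        ring
  have h9 : s ≤ s * logFactor n := le_mul_of_one_le_right (by linarith) (by linarith)
  have h10 : logFactor n ≤ s * logFactor n := le_mul_of_one_le_left (by linarith) h4
  calc levelCost c n k t i ≤ k * ((19 + 8 * c.capRate) * (s * logFactor n)) := by
        rw [levelCost]
        gcongr
        nlinarith
    _ = _ := by rw [costRate]; ring

theorem sum_levelCost_le (hc : 0 ≤ c.capRate) (hn : 2 ≤ n) {t : ℕ} (ht : t ≤ Nat.log 2 (n ^ 2))
    (i : ℕ) : ((List.range (i + 1)).map (levelCost c n k t)).sum ≤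
      3 * costRate c * k * √(3 ^ i) * logFactor n := by
  have hl := logb_le_logFactor hn
  have h3 := one_le_logb hn
  rw [sum_map_range]
  calc ∑ j ∈ Finset.range (i + 1), levelCost c n k t j
      ≤ ∑ j ∈ Finset.range (i + 1), costRate c * k * √(3 ^ j) * logFactor n :=
        Finset.sum_le_sum fun j _ => levelCost_le c hc hn ht j
    _ = costRate c * k * logFactor n * ∑ j ∈ Finset.range (i + 1), √(3 ^ j) := by
        rw [Finset.mul_sum]
        exact Finset.sum_congr rfl fun j _ => by ring
    _ ≤ costRate c * k * logFactor n * (3 * √(3 ^ i)) := by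
        have : 0 ≤ costRate c := by rw [costRate]; positivity
        have : 0 ≤ logFactor n := by linarith
        gcongr
        exact sum_sqrt_pow_le i
    _ = _ := by ring

variable (X : Fin k → SimpleGraph (Fin n)) (ω : Coins n)

theorem knownCoordinator_eval_snd_le (hc : 0 ≤ c.capRate) (hγ : 1 ≤ c.rangeRate) (hn : 2 ≤ n)
    {t : ℕ} (ht : t ≤ Nat.log 2 (n ^ 2)) :
    (((knownCoordinator c n k t).eval fun j => reply c ω (X j)).2 : ℝ) ≤
      3 * costRate c * √c.rangeRate * k * √√(2 ^ t) * logFactor n := by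
  refine (scan_snd_le c X ω hc (by omega) t _).trans ?_
  have hmem : Nat.log 3 ⌊c.rangeRate * √(2 ^ t)⌋₊ ∈ levels c t := by
    rw [levels]
    exact List.mem_range.2 (Nat.lt_succ_self _)
  refine (sum_levelCost_le c hc hn ht _).trans ?_
  have h1 := Real.sqrt_le_sqrt (le_of_mem_levels c hγ hmem)
  rw [Real.sqrt_mul (by linarith)] at h1
  have hl := logb_le_logFactor hn
  have h3 := one_le_logb hn
  have : 0 ≤ costRate c := by rw [costRate]; positivity
  have : 0 ≤ logFactor n := by linarith
  calc _ ≤ 3 * costRate c * k * (√c.rangeRate * √√(2 ^ t)) * logFactor n := by gcongr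
    _ = _ := by ring

theorem knownCoordinator_eval_of_succeeds (hc : 0 ≤ c.capRate) (hn : 2 ≤ n)
    {t i : ℕ} (ht : t ≤ Nat.log 2 (n ^ 2)) (hi : i ∈ levels c t)
    (h : LevelSucceeds c (inputGraph X) t i ω.2) :
    ((knownCoordinator c n k t).eval fun j => reply c ω (X j)).1 ≠ none ∧
    (((knownCoordinator c n k t).eval fun j => reply c ω (X j)).2 : ℝ) ≤
      3 * costRate c * k * √(3 ^ i) * logFactor n := by
  obtain ⟨post, hpost⟩ := exists_levels_eq c hi
  have := scan_of_succeeds c X ω hc (by omega) (t := t) (List.range i) post h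
  rw [← List.range_succ] at this
  rw [knownCoordinator, hpost]
  exact ⟨this.1, this.2.trans (sum_levelCost_le c hc hn ht i)⟩

/-! ### The probability of success of a level -/

variable [NeZero n] {G : SimpleGraph (Fin n)}

/-- If many vertices are rich, then with high probability both edges of a triangle-vee are
sampled: some rich vertex is sampled as a source, and then some vee with this source. -/
theorem uniformProb_no_vee_le {t i : ℕ} {θ x y : ℝ} (F : Finset (Fin n))
    (hF : ∀ v ∈ F, IsRich G θ v) (hx : x ≤ vertexProb c n t i * F.card)
    (hy : y ≤ neighborProb c n i ^ 2 * θ) :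
    uniformProb (fun ω : Samples n => ¬ ∃ v u w, (v, u) ∈ sample c t i ω G ∧
      (v, w) ∈ sample c t i ω G ∧ G.Adj u w) ≤ Real.exp (-x) + Real.exp (-y) := by
  have hmiss : uniformProb (fun f : Fin n → Fin (n ^ 2) => ∀ v ∈ F, ¬ IsSource c t i f v) ≤
      Real.exp (-x) := by
    refine (uniformProb_forall_not F
      fun a : Fin (n ^ 2) => (a : ℕ) < ⌈vertexProb c n t i * (n ^ 2 : ℕ)⌉₊).trans_le ?_
    refine (one_sub_uniformProb_pow_le _ _ (one_sub_uniformProb_lt_ceil_le _)).trans ?_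
    exact Real.exp_le_exp.2 (by linarith)
  have hpair (f : Fin n → Fin (n ^ 2)) : uniformProb (fun g => (∃ v ∈ F, IsSource c t i f v) ∧
      ¬ ∃ v u w, (v, u) ∈ sample c t i (f, g) G ∧ (v, w) ∈ sample c t i (f, g) G ∧ G.Adj u w) ≤
      Real.exp (-y) := by
    by_cases hf : ∃ v ∈ F, IsSource c t i f v
    · obtain ⟨v, hv, hfv⟩ := hf
      obtain ⟨I, u, w, hu, hw, hI, hadj⟩ := hF v hv
      have h1 := uniformProb_forall_not_pair I hu hw
        fun a : Fin (n ^ 2) => (a : ℕ) < ⌈neighborProb c n i * (n ^ 2 : ℕ)⌉₊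
      refine (uniformProb_mono fun g hg e he hue => ?_).trans (h1.trans_le ?_)
      · refine hg.2 ⟨v, u e, w e, ?_, ?_, (hadj e he).2.2⟩
        · exact (mem_sample c).2 ⟨(hadj e he).1, hfv, Or.inl hue.1⟩
        · exact (mem_sample c).2 ⟨(hadj e he).2.1, hfv, Or.inr hue.2⟩
      · set ρ := uniformProb fun a : Fin (n ^ 2) => (a : ℕ) < ⌈neighborProb c n i * (n ^ 2 : ℕ)⌉₊
        have hρ0 : 0 ≤ ρ := uniformProb_nonneg _
        have hρ1 : ρ ≤ 1 := uniformProb_le_one _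
        have h2 := one_sub_uniformProb_lt_ceil_sq_le (N := n ^ 2) (p := neighborProb c n i)
          (Real.sqrt_nonneg _)
        refine (pow_le_pow_left₀ (by nlinarith) h2 _).trans ?_
        rw [← Real.exp_nat_mul, Real.exp_le_exp]
        have : neighborProb c n i ^ 2 * θ ≤ neighborProb c n i ^ 2 * I.card := by gcongr
        linarith
    · simp only [hf, false_and]
      refine le_trans (le_of_eq ?_) (Real.exp_pos _).le
      simp [uniformProb]
  refine (uniformProb_mono (T := fun ω : Samples n =>
    (∀ v ∈ F, ¬ IsSource c t i ω.1 v) ∨ ((∃ v ∈ F, IsSource c t i ω.1 v) ∧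
      ¬ ∃ v u w, (v, u) ∈ sample c t i ω G ∧ (v, w) ∈ sample c t i ω G ∧ G.Adj u w))
    fun ω h => ?_).trans ((uniformProb_or_le _ _).trans (add_le_add ?_ ?_))
  · by_cases hs : ∃ v ∈ F, IsSource c t i ω.1 v
    · exact Or.inr ⟨hs, h⟩
    · push Not at hs
      exact Or.inl hs
  · exact (uniformProb_fst _).trans_le hmiss
  · exact uniformProb_prod_le hpair

theorem expect_card_sample_le {t i : ℕ} (hq : 1 ≤ vertexProb c n t i * (n ^ 2 : ℕ))
    (hp : 1 ≤ neighborProb c n i * (n ^ 2 : ℕ)) :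
    𝔼 ω : Samples n, ((sample c t i ω G).card : ℝ) ≤
      16 * numEdges G * vertexProb c n t i * neighborProb c n i := by
  classical
  have hN : (0 : ℝ) < (n ^ 2 : ℕ) := Nat.cast_pos.2 (NeZero.pos _)
  have hq0 : 0 ≤ vertexProb c n t i := by
    by_contra! h
    nlinarith
  have hp0 : 0 ≤ neighborProb c n i := Real.sqrt_nonneg _
  have hS (p : Fin n × Fin n) : uniformProb (fun ω : Samples n => IsSource c t i ω.1 p.1 ∧
      (IsEndpoint c i ω.2.1 p.2 ∨ IsEndpoint c i ω.2.2 p.2)) ≤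
      2 * vertexProb c n t i * (2 * neighborProb c n i + 2 * neighborProb c n i) := by
    have he : uniformProb (fun g : Fin n → Fin (n ^ 2) => IsEndpoint c i g p.2) ≤
        2 * neighborProb c n i :=
      (uniformProb_apply p.2 fun a : Fin (n ^ 2) =>
        (a : ℕ) < ⌈neighborProb c n i * (n ^ 2 : ℕ)⌉₊).trans_le (uniformProb_lt_ceil_le hp)
    rw [uniformProb_and_prod (fun f => IsSource c t i f p.1)
      fun g : (Fin n → Fin (n ^ 2)) × (Fin n → Fin (n ^ 2)) =>
        IsEndpoint c i g.1 p.2 ∨ IsEndpoint c i g.2 p.2]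
    refine mul_le_mul ?_ ?_ (uniformProb_nonneg _) (by positivity)
    · exact (uniformProb_apply p.1 fun a : Fin (n ^ 2) =>
        (a : ℕ) < ⌈vertexProb c n t i * (n ^ 2 : ℕ)⌉₊).trans_le (uniformProb_lt_ceil_le hq)
    · refine (uniformProb_or_le _ _).trans (add_le_add ?_ ?_)
      · exact (uniformProb_fst fun g => IsEndpoint c i g p.2).trans_le he
      · exact (uniformProb_snd fun g => IsEndpoint c i g p.2).trans_le he
  have hcard (ω : Samples n) : ((sample c t i ω G).card : ℝ) =
      ∑ p ∈ Finset.univ.filter fun p : Fin n × Fin n => G.Adj p.1 p.2,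
        if IsSource c t i ω.1 p.1 ∧ (IsEndpoint c i ω.2.1 p.2 ∨ IsEndpoint c i ω.2.2 p.2)
          then (1 : ℝ) else 0 := by
    rw [Finset.sum_boole, Finset.filter_filter]
    congr!
  simp only [hcard]
  rw [Finset.expect_sum_comm]
  calc _ ≤ ∑ _p ∈ Finset.univ.filter fun p : Fin n × Fin n => G.Adj p.1 p.2,
        2 * vertexProb c n t i * (2 * neighborProb c n i + 2 * neighborProb c n i) := by
        refine Finset.sum_le_sum fun p _ => ?_
        rw [← uniformProb_def]
        exact hS p
    _ = _ := by
        rw [Finset.sum_const, card_adj_pairs, nsmul_eq_mul]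
        push_cast
        ring

/-- If bucket `i + 1` is full and the number of edges is known up to a factor `C`, then level `i`
succeeds with high probability. -/
theorem uniformProb_not_levelSucceeds_le {ε C : ℝ} (hε : 0 < ε) (hC : 1 ≤ C)
    (hA : C ≤ c.vertexRate) (hB : 1 ≤ c.neighborRate) (hκ : 0 < c.capRate) (hn : 2 ≤ n)
    (hm : 0 < numEdges G) {t i : ℕ} (h1 : (numEdges G : ℝ) ≤ C * 2 ^ t)
    (h2 : (2 : ℝ) ^ t ≤ C * numEdges G) (hi : IsFullBucket ε G (i + 1)) :
    uniformProb (fun ω => ¬ LevelSucceeds c G t i ω) ≤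
      16 * C * c.vertexRate * √c.neighborRate / c.capRate +
        (Real.exp (-(c.vertexRate * ε / (12 * C))) + Real.exp (-(c.neighborRate * ε / 8))) := by
  have hl := one_le_logb hn
  obtain ⟨F, hF, hrich⟩ := exists_isRich hε hn hi
  set m : ℝ := (numEdges G : ℝ) with hmdef
  have hm0 : 0 < m := Nat.cast_pos.2 hm
  set l := Real.logb 2 n with hldef
  have hA0 : 0 < c.vertexRate := by linarith
  have hB0 : 0 < c.neighborRate := by linarith
  have hD : (0 : ℝ) < 3 ^ i := by positivity
  have ht : (0 : ℝ) < 2 ^ t := by positivity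
  have hn0 : (0 : ℝ) < n := by exact_mod_cast (by omega : 0 < n)
  have hDn : (3 : ℝ) ^ i ≤ n := by
    have hFpos : (0 : ℝ) < F.card := lt_of_lt_of_le (by positivity) hF
    obtain ⟨v, hv⟩ : F.Nonempty := Finset.card_pos.1 (by exact_mod_cast hFpos)
    exact_mod_cast (hrich v hv).2.1.trans (deg_lt G v).le
  have hmn : m ≤ (n : ℝ) ^ 2 := by
    have := numEdges_le G
    rw [hmdef]
    exact_mod_cast (by omega : numEdges G ≤ n ^ 2)
  -- Both probabilities are at least `1 / n ^ 2`, the granularity of the random values.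
  have hq : 1 ≤ vertexProb c n t i * (n ^ 2 : ℕ) := by
    rw [vertexProb, div_mul_eq_mul_div, le_div_iff₀ ht, one_mul]
    push_cast
    have h3 : (1 : ℝ) ≤ 3 ^ i := one_le_pow₀ (by norm_num)
    calc (2 : ℝ) ^ t ≤ C * m := h2
      _ ≤ c.vertexRate * (n : ℝ) ^ 2 := by gcongr
      _ = c.vertexRate * 1 * 1 * (n : ℝ) ^ 2 := by ring
      _ ≤ c.vertexRate * 3 ^ i * l * (n : ℝ) ^ 2 := by gcongr
  have hp : 1 ≤ neighborProb c n i * (n ^ 2 : ℕ) := by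
    have h3 : 1 / (n : ℝ) ^ 2 ≤ neighborProb c n i := by
      refine Real.le_sqrt_of_sq_le ?_
      have h4 : (1 : ℝ) ≤ n := by exact_mod_cast (by omega : 1 ≤ n)
      have h5 : 1 / (n : ℝ) ^ 2 ≤ 1 / n :=
        one_div_le_one_div_of_le hn0 (by nlinarith)
      have h6 : 1 / (n : ℝ) ^ 2 ≤ 1 := by
        rw [div_le_one (by positivity)]
        exact one_le_pow₀ h4
      calc (1 / (n : ℝ) ^ 2) ^ 2 ≤ 1 / (n : ℝ) ^ 2 := by
            rw [sq]
            exact mul_le_of_le_one_left (by positivity) h6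
        _ ≤ 1 / (n : ℝ) := h5
        _ ≤ c.neighborRate * l / 3 ^ i := by
            gcongr
            nlinarith
    push_cast
    rwa [div_le_iff₀ (by positivity)] at h3
  refine (uniformProb_mono (T := fun ω : Samples n =>
    capacity c n i < (sample c t i ω G).card ∨ ¬ ∃ v u w, (v, u) ∈ sample c t i ω G ∧
      (v, w) ∈ sample c t i ω G ∧ G.Adj u w) fun ω h => ?_).trans
    ((uniformProb_or_le _ _).trans (add_le_add ?_ ?_))
  · by_contra! h'
    exact h ⟨h'.1, h'.2⟩
  · have hs : 0 < √((3 : ℝ) ^ i) * (l * √l) := by positivity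
    have hcap : 0 < capacity c n i := mul_pos hκ hs
    refine (uniformProb_lt_le (fun ω => Nat.cast_nonneg _) hcap).trans ?_
    rw [div_le_div_iff₀ hcap hκ]
    refine (mul_le_mul_of_nonneg_right (expect_card_sample_le c hq hp) hκ.le).trans ?_
    have h3 : neighborProb c n i = √c.neighborRate * √l / √(3 ^ i) := by
      rw [neighborProb, Real.sqrt_div (by positivity), Real.sqrt_mul hB0.le]
    have h4 : (3 : ℝ) ^ i = √(3 ^ i) * √(3 ^ i) := (Real.mul_self_sqrt hD.le).symm
    -- Up to constants, `m * (D log n / m) * √(log n / D) = √D * log n ^ (3/2)`.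
    have h5 : vertexProb c n t i * neighborProb c n i =
        c.vertexRate * √c.neighborRate * (√(3 ^ i) * (l * √l)) / 2 ^ t := by
      rw [h3, vertexProb, ← hldef]
      field_simp
      rw [Real.sq_sqrt hD.le]
    calc 16 * m * vertexProb c n t i * neighborProb c n i * c.capRate
        = 16 * m * (c.vertexRate * √c.neighborRate * (√(3 ^ i) * (l * √l)) / 2 ^ t) *
          c.capRate := by rw [mul_assoc (16 * m), h5]
      _ ≤ 16 * (C * 2 ^ t) * (c.vertexRate * √c.neighborRate * (√(3 ^ i) * (l * √l)) / 2 ^ t) *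
          c.capRate := by gcongr
      _ = 16 * C * c.vertexRate * √c.neighborRate * (c.capRate * (√(3 ^ i) * (l * √l))) := by
          field_simp
  · refine uniformProb_no_vee_le c F (fun v hv => (hrich v hv).2.2) ?_ ?_
    · calc c.vertexRate * ε / (12 * C) = c.vertexRate * ε * 2 ^ t / (12 * C * 2 ^ t) := by
            field_simp
        _ ≤ c.vertexRate * ε * (C * m) / (12 * C * 2 ^ t) := by gcongr
        _ = vertexProb c n t i * (ε * m / (12 * 3 ^ i * l)) := by
            rw [vertexProb, ← hldef]
            field_simp
        _ ≤ vertexProb c n t i * F.card := by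
            have : 0 ≤ vertexProb c n t i := by
              rw [vertexProb]
              positivity
            gcongr
    · rw [neighborProb, Real.sq_sqrt (by positivity), ← hldef]
      refine le_of_eq ?_
      field_simp

/-! ### Estimating the number of edges -/

theorem lt_div_iff_le_log {N x τ : ℕ} (hx : x < N) :
    x < N / 2 ^ τ ↔ τ ≤ Nat.log 2 (N / (x + 1)) := by
  have h0 : N / (x + 1) ≠ 0 := (Nat.div_pos hx (Nat.succ_pos x)).ne'
  rw [Nat.le_log_iff_pow_le (by norm_num) h0, Nat.le_div_iff_mul_le (Nat.succ_pos x),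
    ← Nat.succ_le_iff, Nat.le_div_iff_mul_le (by positivity), mul_comm]

theorem uniformProb_le_edgeLevel (G : SimpleGraph (Fin n)) {τ : ℕ} (hτ : 0 < τ) :
    uniformProb (fun h : Sym2 (Fin n) → Fin (n ^ 2) => τ ≤ edgeLevel h G) ≤
      numEdges G / 2 ^ τ := by
  classical
  have hN : (0 : ℝ) < (n ^ 2 : ℕ) := Nat.cast_pos.2 (NeZero.pos _)
  refine (uniformProb_mono (T := fun h : Sym2 (Fin n) → Fin (n ^ 2) =>
    ∃ e ∈ Finset.univ.filter fun e => e ∈ G.edgeSet, (h e : ℕ) < n ^ 2 / 2 ^ τ)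
    fun h hh => ?_).trans ?_
  · obtain ⟨e, he, hle⟩ := (Finset.le_sup_iff hτ).1 hh
    exact ⟨e, by simpa using he, (lt_div_iff_le_log (h e).2).2 hle⟩
  · refine (uniformProb_exists_le _ _).trans ?_
    calc _ ≤ ∑ e ∈ Finset.univ.filter fun e => e ∈ G.edgeSet, 1 / (2 : ℝ) ^ τ := by
          refine Finset.sum_le_sum fun e _ => ?_
          rw [uniformProb_apply e fun x : Fin (n ^ 2) => (x : ℕ) < n ^ 2 / 2 ^ τ, uniformProb_lt,
            div_le_iff₀ hN]
          calc ((min (n ^ 2) (n ^ 2 / 2 ^ τ) : ℕ) : ℝ) ≤ ((n ^ 2 / 2 ^ τ : ℕ) : ℝ) := by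
                exact_mod_cast min_le_right _ _
            _ ≤ ((n ^ 2 : ℕ) : ℝ) / ((2 ^ τ : ℕ) : ℝ) := Nat.cast_div_le
            _ = 1 / (2 : ℝ) ^ τ * (n ^ 2 : ℕ) := by
                push_cast
                ring
      _ = _ := by
          rw [Finset.sum_const, card_edges, nsmul_eq_mul]
          ring

theorem uniformProb_edgeLevel_lt (G : SimpleGraph (Fin n)) {τ : ℕ} (hτ : 2 ^ τ ≤ n ^ 2) :
    uniformProb (fun h : Sym2 (Fin n) → Fin (n ^ 2) => edgeLevel h G < τ) ≤
      Real.exp (-(numEdges G / (2 * 2 ^ τ))) := by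
  classical
  have hN : (0 : ℝ) < (n ^ 2 : ℕ) := Nat.cast_pos.2 (NeZero.pos _)
  refine (uniformProb_mono (T := fun h : Sym2 (Fin n) → Fin (n ^ 2) =>
    ∀ e ∈ Finset.univ.filter fun e => e ∈ G.edgeSet, ¬ (h e : ℕ) < n ^ 2 / 2 ^ τ)
    fun h hh e he hlt => ?_).trans ?_
  · have h1 := (lt_div_iff_le_log (h e).2).1 hlt
    have h2 : Nat.log 2 (n ^ 2 / (h e + 1)) ≤ edgeLevel h G :=
      Finset.le_sup (f := fun e => Nat.log 2 (n ^ 2 / (h e + 1))) (by simpa using he)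
    omega
  · rw [uniformProb_forall_not _ fun x : Fin (n ^ 2) => (x : ℕ) < n ^ 2 / 2 ^ τ, card_edges]
    have hρ : 1 / (2 * 2 ^ τ) ≤
        uniformProb fun x : Fin (n ^ 2) => (x : ℕ) < n ^ 2 / 2 ^ τ := by
      rw [uniformProb_lt, min_eq_right (Nat.div_le_self _ _), div_le_div_iff₀ (by positivity) hN,
        one_mul]
      have h1 : 1 ≤ n ^ 2 / 2 ^ τ := (Nat.one_le_div_iff (by positivity)).2 hτ
      have h2 := Nat.lt_div_mul_add (a := n ^ 2) (b := 2 ^ τ) (by positivity)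
      have h3 : n ^ 2 ≤ n ^ 2 / 2 ^ τ * (2 * 2 ^ τ) := by nlinarith
      exact_mod_cast h3
    refine (one_sub_uniformProb_pow_le _ (x := 1 / (2 * 2 ^ τ)) _ ?_).trans_eq ?_
    · have := Real.one_sub_le_exp_neg (1 / (2 * 2 ^ τ))
      linarith
    · congr 1
      ring

theorem exp_neg_le_inv {x : ℝ} (hx : 0 < x) : Real.exp (-x) ≤ 1 / x := by
  rw [Real.exp_neg, ← one_div]
  exact one_div_le_one_div_of_le hx (by linarith [Real.add_one_le_exp x])

/-- With high probability the estimate of the number of edges is correct up to a factor `C`. -/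
theorem uniformProb_bad_estimate_le (G : SimpleGraph (Fin n)) (hm : 0 < numEdges G) {C : ℕ}
    (hC : 2 ≤ C) :
    uniformProb (fun h : Sym2 (Fin n) → Fin (n ^ 2) =>
      ¬ ((numEdges G : ℝ) ≤ C * 2 ^ edgeLevel h G ∧
        (2 : ℝ) ^ edgeLevel h G ≤ C * numEdges G)) ≤ 5 / C := by
  set m := numEdges G with hmdef
  have hC0 : (0 : ℝ) < C := by exact_mod_cast (by omega : 0 < C)
  -- The probability of a level at least `τ` is at most `m / 2 ^ τ`, and here `2 ^ τ > C * m`.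
  have hupper : uniformProb (fun h : Sym2 (Fin n) → Fin (n ^ 2) => C * m < 2 ^ edgeLevel h G) ≤
      1 / C := by
    set τ := Nat.log 2 (C * m) + 1
    have hτ : C * m < 2 ^ τ := Nat.lt_pow_succ_log_self (by norm_num) _
    refine (uniformProb_mono (T := fun h => τ ≤ edgeLevel h G) fun h hh => ?_).trans
      ((uniformProb_le_edgeLevel G (Nat.succ_pos _)).trans ?_)
    · exact Nat.log_lt_of_lt_pow (by positivity) hh
    · rw [div_le_div_iff₀ (by positivity) hC0, one_mul, mul_comm]
      exact_mod_cast hτ.le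
  -- The probability of no level at least `τ` is at most `exp (-m / 2 ^ (τ + 1))`, and here
  -- `2 ^ τ ≤ 2 * m / C`.
  have hlower : uniformProb (fun h : Sym2 (Fin n) → Fin (n ^ 2) => C * 2 ^ edgeLevel h G < m) ≤
      4 / C := by
    rcases Nat.eq_zero_or_pos (m / C) with h0 | hpos
    · refine le_trans (le_of_eq ?_) (by positivity : (0 : ℝ) ≤ 4 / C)
      have hmC : m < C := (Nat.div_eq_zero_iff_lt (by omega)).1 h0
      have (h : Sym2 (Fin n) → Fin (n ^ 2)) : ¬ C * 2 ^ edgeLevel h G < m := by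
        have : 1 ≤ 2 ^ edgeLevel h G := Nat.one_le_two_pow
        nlinarith
      simp [uniformProb, this]
    · set τ := Nat.log 2 (m / C) + 1 with hτdef
      have hτ : C * 2 ^ τ ≤ 2 * m := by
        have h1 := Nat.pow_log_le_self 2 hpos.ne'
        have h2 := Nat.div_mul_le_self m C
        rw [hτdef, pow_succ]
        nlinarith
      have hN : 2 ^ τ ≤ n ^ 2 := by
        have := numEdges_le G
        have h1 : 1 ≤ 2 ^ τ := Nat.one_le_two_pow
        nlinarith
      refine (uniformProb_mono (T := fun h => edgeLevel h G < τ) fun h hh => ?_).trans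
        ((uniformProb_edgeLevel_lt G hN).trans ?_)
      · refine Nat.lt_succ_of_le (Nat.le_log_of_pow_le (by norm_num) ?_)
        rw [Nat.le_div_iff_mul_le (by omega), mul_comm]
        exact hh.le
      · have hτ' : (C : ℝ) * 2 ^ τ ≤ 2 * m := by exact_mod_cast hτ
        have hx : (C : ℝ) / 4 ≤ m / (2 * 2 ^ τ) := by
          rw [div_le_div_iff₀ (by norm_num) (by positivity)]
          nlinarith
        refine (Real.exp_le_exp.2 (neg_le_neg hx)).trans ?_
        refine (exp_neg_le_inv (by positivity)).trans_eq ?_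
        rw [one_div_div]
  refine (uniformProb_mono (T := fun h : Sym2 (Fin n) → Fin (n ^ 2) =>
    C * m < 2 ^ edgeLevel h G ∨ C * 2 ^ edgeLevel h G < m) fun h hh => ?_).trans
    ((uniformProb_or_le _ _).trans ((add_le_add hupper hlower).trans_eq ?_))
  · by_contra! h'
    exact hh ⟨by exact_mod_cast h'.2, by exact_mod_cast h'.1⟩
  · ring

theorem sqrt_sqrt_pow (τ : ℕ) : √√((2 : ℝ) ^ τ) = √√2 ^ τ := by
  induction τ with
  | zero => simp
  | succ τ ih => rw [pow_succ, pow_succ, Real.sqrt_mul (by positivity),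
      Real.sqrt_mul (by positivity), ih]

theorem sqrt_sqrt_pow_four {x : ℝ} (hx : 0 ≤ x) : √√x ^ 4 = x := by
  rw [show 4 = 2 * 2 by rfl, pow_mul, Real.sq_sqrt (Real.sqrt_nonneg _), Real.sq_sqrt hx]

/-- The fourth root of the estimate of the number of edges is correct in expectation. -/
theorem expect_sqrt_sqrt_le (G : SimpleGraph (Fin n)) :
    𝔼 h : Sym2 (Fin n) → Fin (n ^ 2), √√((2 : ℝ) ^ edgeLevel h G) ≤
      1 + 4 * √√(numEdges G : ℝ) := by
  classical
  set m := numEdges G with hmdef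
  rcases Nat.eq_zero_or_pos m with h0 | hm
  · have hz (h : Sym2 (Fin n) → Fin (n ^ 2)) : edgeLevel h G = 0 := by
      have := card_edges G
      rw [← hmdef, h0, Finset.card_eq_zero] at this
      rw [edgeLevel, this]
      rfl
    simp only [hz]
    rw [h0]
    simp
  set r : ℝ := √√2 with hr
  have hr0 : 0 < r := by positivity
  have hr4 : r ^ 4 = 2 := sqrt_sqrt_pow_four (by norm_num)
  have hr1 : r ≤ 1.2 := by
    by_contra! h
    have := pow_lt_pow_left₀ h (by norm_num) (by norm_num : (4 : ℕ) ≠ 0)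
    norm_num [hr4] at this
  have hr1' : 1 ≤ r := Real.one_le_sqrt.2 (Real.one_le_sqrt.2 (by norm_num))
  set μ : ℝ := √√(m : ℝ) with hμ
  have hμ4 : μ ^ 4 = m := sqrt_sqrt_pow_four (Nat.cast_nonneg _)
  have hm0 : (0 : ℝ) < m := Nat.cast_pos.2 hm
  have hμ0 : 0 < μ := by positivity
  set τ₀ := Nat.log 2 m + 1 with hτ₀
  set R := Nat.log 2 (n ^ 2) + 1 with hR
  -- Once `2 ^ τ > m`, the level is at least `τ` with probability at most `m / 2 ^ τ`, while the
  -- fourth root grows only by the factor `r` per level: the tail is a geometric sum.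
  have hpoint (h : Sym2 (Fin n) → Fin (n ^ 2)) : √√((2 : ℝ) ^ edgeLevel h G) ≤
      μ + ∑ τ ∈ Finset.Ico τ₀ R, r ^ τ * if τ ≤ edgeLevel h G then (1 : ℝ) else 0 := by
    have hterm (τ : ℕ) : 0 ≤ r ^ τ * if τ ≤ edgeLevel h G then (1 : ℝ) else 0 := by
      split_ifs <;> positivity
    by_cases hT : edgeLevel h G < τ₀
    · have h1 : (2 : ℝ) ^ edgeLevel h G ≤ m := by
        have h2 : 2 ^ edgeLevel h G ≤ m :=
          (Nat.pow_le_pow_right two_pos (Nat.lt_succ_iff.1 hT)).trans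
            (Nat.pow_log_le_self 2 hm.ne')
        exact_mod_cast h2
      have h3 := Real.sqrt_le_sqrt (Real.sqrt_le_sqrt h1)
      have h4 := Finset.sum_nonneg fun τ (_ : τ ∈ Finset.Ico τ₀ R) => hterm τ
      linarith
    · have hmem : edgeLevel h G ∈ Finset.Ico τ₀ R :=
        Finset.mem_Ico.2 ⟨not_lt.1 hT, Nat.lt_succ_of_le (edgeLevel_le h G)⟩
      have h1 := Finset.single_le_sum (fun τ _ => hterm τ) hmem
      rw [if_pos le_rfl, mul_one, ← sqrt_sqrt_pow] at h1
      linarith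
  have hgeom : ∑ τ ∈ Finset.Ico τ₀ R, (r / 2) ^ τ ≤ (r / 2) ^ τ₀ / (1 - r / 2) :=
    geom_sum_Ico_le_of_lt_one (by positivity) (by linarith)
  have hy : (m : ℝ) * (r / 2) ^ τ₀ ≤ μ := by
    have h1 : μ ≤ r ^ τ₀ := by
      rw [← sqrt_sqrt_pow]
      refine Real.sqrt_le_sqrt (Real.sqrt_le_sqrt ?_)
      exact_mod_cast (Nat.lt_pow_succ_log_self (by norm_num) m).le
    have h2 : (r / 2) ^ τ₀ = 1 / (r ^ τ₀) ^ 3 := by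
      rw [← hr4, eq_div_iff (by positivity), ← pow_mul, mul_comm τ₀ 3, pow_mul, ← mul_pow]
      have : r / r ^ 4 * r ^ 3 = 1 := by field_simp
      rw [this, one_pow]
    rw [h2, mul_one_div, div_le_iff₀ (by positivity), ← hμ4]
    calc μ ^ 4 = μ * μ ^ 3 := by ring
      _ ≤ μ * (r ^ τ₀) ^ 3 := by gcongr
  calc 𝔼 h : Sym2 (Fin n) → Fin (n ^ 2), √√((2 : ℝ) ^ edgeLevel h G)
      ≤ 𝔼 h : Sym2 (Fin n) → Fin (n ^ 2),
        (μ + ∑ τ ∈ Finset.Ico τ₀ R, r ^ τ * if τ ≤ edgeLevel h G then (1 : ℝ) else 0) :=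
        Finset.expect_le_expect fun h _ => hpoint h
    _ = μ + ∑ τ ∈ Finset.Ico τ₀ R, r ^ τ *
        uniformProb fun h : Sym2 (Fin n) → Fin (n ^ 2) => τ ≤ edgeLevel h G := by
        rw [Finset.expect_add_distrib, Fintype.expect_const, Finset.expect_sum_comm]
        congr 1
        refine Finset.sum_congr rfl fun τ _ => ?_
        rw [← Finset.mul_expect, uniformProb_def]
    _ ≤ μ + ∑ τ ∈ Finset.Ico τ₀ R, r ^ τ * (m / 2 ^ τ) := by
        gcongr with τ hτ
        exact uniformProb_le_edgeLevel G ((Nat.succ_pos _).trans_le (Finset.mem_Ico.1 hτ).1)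
    _ = μ + m * ∑ τ ∈ Finset.Ico τ₀ R, (r / 2) ^ τ := by
        rw [Finset.mul_sum]
        congr 1
        refine Finset.sum_congr rfl fun τ _ => ?_
        rw [div_pow]
        ring
    _ ≤ μ + m * ((r / 2) ^ τ₀ / (1 - r / 2)) := by gcongr
    _ = μ + (m * (r / 2) ^ τ₀) / (1 - r / 2) := by ring
    _ ≤ μ + μ / (1 - r / 2) := by
        have : 0 < 1 - r / 2 := by linarith
        gcongr
    _ ≤ μ + 3 * μ := by
        have : μ / (1 - r / 2) ≤ 3 * μ := by
          rw [div_le_iff₀ (by linarith)]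
          nlinarith
        gcongr
    _ ≤ 1 + 4 * μ := by linarith

end Analysis

/-! ### The finders -/

section Finders

variable {n k : ℕ} [NeZero n] (c : Rates)

/-- The finder for graphs with about `2 ^ t` edges. -/
noncomputable def knownFinder (n k t : ℕ) [NeZero n] : Finder n k :=
  Protocol.uniform (Coins n) fun ω => .memoryless (knownCoordinator c n k t) (reply c ω)

/-- The finder that estimates the number of edges. -/
noncomputable def unknownFinder (n k : ℕ) [NeZero n] : Finder n k :=
  Protocol.uniform (Coins n) fun ω => .memoryless (unknownCoordinator c n k) (reply c ω)

theorem knownFinder_out (t : ℕ) (X : Fin k → SimpleGraph (Fin n)) (ω : Coins n) :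
    (knownFinder c n k t).out X ω =
      ((knownCoordinator c n k t).eval fun j => reply c ω (X j)).1 :=
  congrArg Prod.fst (DetProtocol.run_memoryless _ _ X)

theorem knownFinder_bits (t : ℕ) (X : Fin k → SimpleGraph (Fin n)) (ω : Coins n) :
    (knownFinder c n k t).bits X ω =
      ((knownCoordinator c n k t).eval fun j => reply c ω (X j)).2 :=
  congrArg Prod.snd (DetProtocol.run_memoryless _ _ X)

theorem unknownFinder_out (X : Fin k → SimpleGraph (Fin n)) (ω : Coins n) :
    (unknownFinder c n k).out X ω =
      ((knownCoordinator c n k (edgeLevel ω.1 (inputGraph X))).eval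
        fun j => reply c ω (X j)).1 :=
  (congrArg Prod.fst (DetProtocol.run_memoryless _ _ X)).trans
    (unknownCoordinator_eval_fst c X ω)

theorem unknownFinder_bits_le (X : Fin k → SimpleGraph (Fin n)) (ω : Coins n) :
    ((unknownFinder c n k).bits X ω : ℝ) ≤ k * (Nat.log 2 (n ^ 2) + 2) +
      ((knownCoordinator c n k (edgeLevel ω.1 (inputGraph X))).eval
        fun j => reply c ω (X j)).2 :=
  (congrArg (fun p : Option (Finset (Fin n)) × ℕ => (p.2 : ℝ))
    (DetProtocol.run_memoryless (unknownCoordinator c n k) (reply c ω) X)).trans_le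
    (unknownCoordinator_eval_snd_le c X ω)

theorem oneSided_knownFinder (t : ℕ) : (knownFinder c n k t).OneSided := by
  intro X ω s h
  exact isNClique_of_scan c X ω ((knownFinder_out c t X ω).symm.trans h)

theorem oneSided_unknownFinder : (unknownFinder c n k).OneSided := by
  intro X ω s h
  exact isNClique_of_scan c X ω ((unknownFinder_out c X ω).symm.trans h)

end Finders

/-! ### The choice of the constants -/

/-- Constants with which, for a graph that is far from triangle-free and whose number of edges is
known up to a factor `C`, the level of the lowest full bucket is scanned and succeeds with
probability at least `1 - δ / 2`. -/
theorem exists_rates {ε δ : ℝ} (hε : 0 < ε) (hδ : 0 < δ) :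
    ∃ (C : ℕ) (c : Rates), 2 ≤ C ∧ 5 / (C : ℝ) ≤ δ / 2 ∧ 0 < c.capRate ∧ 1 ≤ c.rangeRate ∧
      ∀ (n : ℕ) [NeZero n] (G : SimpleGraph (Fin n)), 2 ≤ n → 0 < numEdges G →
        IsFar TriangleFree ε G → ∃ i, IsMinFullBucket ε G (i + 1) ∧
          ∀ t : ℕ, (numEdges G : ℝ) ≤ C * 2 ^ t → (2 : ℝ) ^ t ≤ C * numEdges G →
            i ∈ levels c t ∧ uniformProb (fun ω => ¬ LevelSucceeds c G t i ω) ≤ δ / 2 := by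
  -- `C ≥ 10 / δ` bounds the failure probability `5 / C` of the estimate of `|E|`; `A`, `B` and the
  -- rate of the capacity make each of the three ways in which a level can fail at most `δ / 8`.
  set C : ℕ := ⌈10 / δ⌉₊ + 2 with hC
  have hC10 : 10 / δ ≤ C := (Nat.le_ceil _).trans (by rw [hC]; push_cast; linarith)
  have hC2 : (2 : ℝ) ≤ C := by exact_mod_cast (by omega : 2 ≤ C)
  set A : ℝ := C + 96 * C / (ε * δ) with hA
  set B : ℝ := 1 + 64 / (ε * δ) with hB
  have hA0 : 0 < A := by positivity
  have hB0 : 0 < B := by positivity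
  let c : Rates := ⟨A, B, 128 * C * A * √B / δ, 1 + √(48 * C / ε)⟩
  have hκ : 0 < c.capRate := by
    change 0 < 128 * C * A * √B / δ
    positivity
  have h8 : Real.exp (-(8 / δ)) ≤ δ / 8 :=
    (exp_neg_le_inv (by positivity)).trans_eq (one_div_div _ _)
  refine ⟨C, c, by omega, ?_, hκ, ?_, fun n _ G hn hm hG => ?_⟩
  · rw [div_le_iff₀ hδ] at hC10
    rw [div_le_div_iff₀ (by linarith) (by norm_num)]
    linarith
  · change 1 ≤ 1 + √(48 * C / ε)
    linarith [Real.sqrt_nonneg (48 * C / ε)]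
  · obtain ⟨i, hi, hle⟩ := exists_isMinFullBucket hε hn hm hG
    refine ⟨i, hi, fun t h1 h2 => ⟨mem_levels c ?_, ?_⟩⟩
    · calc (3 : ℝ) ^ i ≤ √(48 / ε) * √(numEdges G) := hle
        _ ≤ √(48 / ε) * √(C * 2 ^ t) := by gcongr
        _ = √(48 * C / ε) * √(2 ^ t) := by
            rw [← Real.sqrt_mul (by positivity), ← Real.sqrt_mul (by positivity)]
            congr 1
            ring
        _ ≤ (1 + √(48 * C / ε)) * √(2 ^ t) := by
            gcongr
            linarith
    · refine (uniformProb_not_levelSucceeds_le c hε (by linarith : (1 : ℝ) ≤ C) ?_ ?_ hκ hn hm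
        h1 h2 hi.1).trans ?_
      · change (C : ℝ) ≤ A
        rw [hA]
        have : 0 ≤ 96 * C / (ε * δ) := by positivity
        linarith
      · change 1 ≤ B
        rw [hB]
        have : 0 ≤ 64 / (ε * δ) := by positivity
        linarith
      · change 16 * C * A * √B / (128 * C * A * √B / δ) +
          (Real.exp (-(A * ε / (12 * C))) + Real.exp (-(B * ε / 8))) ≤ δ / 2
        have e1 : 16 * C * A * √B / (128 * C * A * √B / δ) = δ / 8 := by
          have : √B ≠ 0 := (Real.sqrt_pos.2 hB0).ne'
          field_simp
          norm_num
        have e2 : 8 / δ ≤ A * ε / (12 * C) := by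
          have : A * ε / (12 * C) = ε / 12 + 8 / δ := by
            rw [hA]
            field_simp
            ring
          rw [this]
          linarith
        have e3 : 8 / δ ≤ B * ε / 8 := by
          have : B * ε / 8 = ε / 8 + 8 / δ := by
            rw [hB]
            field_simp
            ring
          rw [this]
          linarith
        have e4 := Real.exp_le_exp.2 (neg_le_neg e2)
        have e5 := Real.exp_le_exp.2 (neg_le_neg e3)
        linarith

/-! ### The communication bound -/

section CommBound

variable {n : ℕ} (k : ℕ) {s : ℝ}

theorem logb_logb_three_pos : 0 < Real.logb 2 (Real.logb 2 3) := by
  refine Real.logb_pos (by norm_num) ?_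
  rw [Real.lt_logb_iff_rpow_lt (by norm_num) (by norm_num)]
  norm_num

theorem logb_logb_le (hn : 3 ≤ n) :
    Real.logb 2 (Real.logb 2 3) ≤ Real.logb 2 (Real.logb 2 n) := by
  have h3 : 0 < Real.logb 2 3 := Real.logb_pos (by norm_num) (by norm_num)
  refine Real.logb_le_logb_of_le (by norm_num) h3 ?_
  exact Real.logb_le_logb_of_le (by norm_num) (by norm_num) (by exact_mod_cast hn)

theorem le_commBound (a : ℕ) (hn : 3 ≤ n) : k * s * logFactor n ≤ commBound a n k s := by
  have h1 := one_le_logb (n := n) (by omega)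
  have h2 := logb_logb_three_pos.trans_le (logb_logb_le hn)
  rw [commBound, ← logFactor_eq (by omega)]
  have : 0 ≤ (k : ℝ) ^ 2 * Real.logb 2 n ^ a * Real.logb 2 (Real.logb 2 n) :=
    mul_nonneg (by positivity) h2.le
  linarith

theorem commBound_nonneg (a : ℕ) (hn : 3 ≤ n) (hs : 0 ≤ s) : 0 ≤ commBound a n k s := by
  have h1 := one_le_logb (n := n) (by omega)
  have h2 := logb_le_logFactor (n := n) (by omega)
  have h3 : 0 ≤ logFactor n := by linarith
  have : 0 ≤ k * s * logFactor n := by positivity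
  exact this.trans (le_commBound k a hn)

theorem mul_logFactor_le_commBound (hn : 3 ≤ n) (hs : 0 ≤ s) :
    k * logFactor n ≤ 1 / Real.logb 2 (Real.logb 2 3) * commBound 4 n k s := by
  have h1 := one_le_logb (n := n) (by omega)
  have h2 := logb_logb_le hn
  have h3 := logb_logb_three_pos
  have h4 := logb_le_logFactor (n := n) (by omega)
  rw [one_div, ← div_eq_inv_mul, le_div_iff₀ h3]
  have h5 : logFactor n ≤ Real.logb 2 n ^ 4 := by
    have : √(Real.logb 2 n) ≤ Real.logb 2 n := by
      rw [Real.sqrt_le_left (by linarith)]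
      nlinarith
    calc logFactor n ≤ Real.logb 2 n ^ 2 * Real.logb 2 n := by
          rw [logFactor]
          gcongr
      _ = Real.logb 2 n ^ 3 := by ring
      _ ≤ Real.logb 2 n ^ 4 := pow_le_pow_right₀ h1 (by norm_num)
  have h6 : (k : ℝ) ≤ (k : ℝ) ^ 2 := by exact_mod_cast Nat.le_self_pow (by norm_num) k
  have h7 : 0 ≤ k * s * Real.logb 2 n ^ (5 / 2 : ℝ) := by
    rw [← logFactor_eq (by omega)]
    have : 0 ≤ logFactor n := by linarith
    positivity
  calc k * logFactor n * Real.logb 2 (Real.logb 2 3)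
      ≤ (k : ℝ) ^ 2 * Real.logb 2 n ^ 4 * Real.logb 2 (Real.logb 2 n) := by
        have : 0 ≤ logFactor n := by linarith
        gcongr
    _ ≤ commBound 4 n k s := by
        rw [commBound]
        linarith

theorem commBound_four_le_five (hn : 3 ≤ n) : commBound 4 n k s ≤ commBound 5 n k s := by
  have h1 := one_le_logb (n := n) (by omega)
  have h2 := logb_logb_three_pos.trans_le (logb_logb_le hn)
  rw [commBound, commBound]
  gcongr
  norm_num

theorem sqrt_sqrt_le_rpow {x y : ℝ} (hx : 0 ≤ x) (hxy : x ≤ y) : √√x ≤ y ^ (1 / 4 : ℝ) := by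
  rw [Real.sqrt_eq_rpow, Real.sqrt_eq_rpow, ← Real.rpow_mul hx]
  norm_num
  exact Real.rpow_le_rpow hx hxy (by norm_num)

end CommBound

/-! ### The guarantees of the finders -/

theorem mul_avgDegree {n : ℕ} [NeZero n] (G : SimpleGraph (Fin n)) :
    n * avgDegree G = 2 * numEdges G := by
  have : (n : ℝ) ≠ 0 := Nat.cast_ne_zero.2 (NeZero.ne n)
  rw [avgDegree]
  field_simp

theorem numEdges_pos_of_avgDegree_pos {n : ℕ} {G : SimpleGraph (Fin n)} (h : 0 < avgDegree G) :
    0 < numEdges G := by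
  by_contra! h0
  have : numEdges G = 0 := by omega
  simp [avgDegree, this] at h

/-- Finders for known and for unknown average degree, with the smaller of the two bounds. -/
theorem exists_finders {ε δ : ℝ} (hε : 0 < ε) (hδ : 0 < δ) :
    ∃ K : ℝ, 0 < K ∧ ∀ n k : ℕ, 3 ≤ n →
      (∀ d : ℝ, 0 < d → ∃ P : Finder n k, P.OneSided ∧
        ∀ X : Fin k → SimpleGraph (Fin n), avgDegree (inputGraph X) = d →
          (∀ ω, (P.bits X ω : ℝ) ≤ K * commBound 4 n k ((n * d) ^ (1 / 4 : ℝ))) ∧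
          (IsFar TriangleFree ε (inputGraph X) →
            1 - δ ≤ P.prob (fun ω => P.out X ω ≠ none) ∧ CheapByBucket P X ε δ K 4)) ∧
      (∃ P : Finder n k, P.OneSided ∧
        ∀ X : Fin k → SimpleGraph (Fin n),
          P.expectedBits X ≤
            K * commBound 4 n k ((n * avgDegree (inputGraph X)) ^ (1 / 4 : ℝ)) ∧
          (0 < avgDegree (inputGraph X) → IsFar TriangleFree ε (inputGraph X) →
            1 - δ ≤ P.prob (fun ω => P.out X ω ≠ none) ∧ CheapByBucket P X ε δ K 4)) := by
  obtain ⟨C, c, hC, hCδ, hκ, hγ, hrates⟩ := exists_rates hε hδ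
  have hC1 : (2 : ℝ) ≤ C := by exact_mod_cast hC
  set W := 3 * costRate c with hW
  set g := √c.rangeRate with hg
  set K₀ := 1 / Real.logb 2 (Real.logb 2 3) with hK₀
  have hW0 : 0 ≤ W := by rw [hW, costRate]; positivity
  have hg0 : 0 ≤ g := Real.sqrt_nonneg _
  have hK₀0 : 0 ≤ K₀ := (one_div_pos.2 logb_logb_three_pos).le
  set K := 4 + W + 4 * W * g + (4 + W * g) * K₀ with hK
  have hWK : W + 4 ≤ K := by
    have : 0 ≤ 4 * W * g + (4 + W * g) * K₀ := by positivity
    linarith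
  have hWgK : W * g ≤ K := by
    have : 0 ≤ 4 + W + 3 * W * g + (4 + W * g) * K₀ := by positivity
    linarith
  have hK0 : 0 < K := by linarith
  refine ⟨K, hK0, fun n k hn => ?_⟩
  have : NeZero n := ⟨by omega⟩
  have hn2 : 2 ≤ n := by omega
  have hl := one_le_logb hn2
  have hlL := logb_le_logFactor hn2
  have hL0 : 0 ≤ logFactor n := by linarith
  refine ⟨fun d hd => ?_, unknownFinder c n k, oneSided_unknownFinder c, fun X => ?_⟩
  · refine ⟨knownFinder c n k (Nat.log 2 ⌊n * d / 2⌋₊), oneSided_knownFinder c _, fun X hX => ?_⟩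
    set G := inputGraph X with hGdef
    have hm : 0 < numEdges G := numEdges_pos_of_avgDegree_pos (hX ▸ hd)
    have hnd : n * d = 2 * numEdges G := by rw [← hX, mul_avgDegree]
    have hfloor : ⌊n * d / 2⌋₊ = numEdges G := by
      rw [hnd, mul_div_cancel_left₀ _ two_ne_zero, Nat.floor_natCast]
    rw [hfloor]
    set t := Nat.log 2 (numEdges G) with ht
    have htn : t ≤ Nat.log 2 (n ^ 2) := Nat.log_mono_right (by
      have := numEdges_le G
      omega)
    have ht1 : (2 : ℝ) ^ t ≤ numEdges G := by exact_mod_cast Nat.pow_log_le_self 2 hm.ne'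
    have ht2 : (numEdges G : ℝ) ≤ 2 * 2 ^ t := by
      have := (Nat.lt_pow_succ_log_self (b := 2) (by norm_num) (numEdges G)).le
      rw [pow_succ'] at this
      exact_mod_cast this
    refine ⟨fun ω => ?_, fun hfar => ?_⟩
    · refine (congrArg Nat.cast (knownFinder_bits c t X ω)).trans_le ?_
      refine (knownCoordinator_eval_snd_le c X ω hκ.le hγ hn2 htn).trans ?_
      have hs : √√((2 : ℝ) ^ t) ≤ (n * d) ^ (1 / 4 : ℝ) :=
        sqrt_sqrt_le_rpow (by positivity) (by rw [hnd]; linarith)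
      have hs0 : 0 ≤ (n * d) ^ (1 / 4 : ℝ) := (Real.sqrt_nonneg _).trans hs
      calc W * g * k * √√(2 ^ t) * logFactor n
          ≤ W * g * k * (n * d) ^ (1 / 4 : ℝ) * logFactor n := by gcongr
        _ = W * g * (k * (n * d) ^ (1 / 4 : ℝ) * logFactor n) := by ring
        _ ≤ K * commBound 4 n k ((n * d) ^ (1 / 4 : ℝ)) :=
          mul_le_mul hWgK (le_commBound k 4 hn) (by positivity) hK0.le
    · obtain ⟨i, hi, hrate⟩ := hrates n G hn2 hm hfar
      obtain ⟨hmem, hprob⟩ := hrate t (ht2.trans (by gcongr)) (ht1.trans (by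
        have : (0 : ℝ) ≤ numEdges G := Nat.cast_nonneg _
        nlinarith))
      have hgood : 1 - δ ≤ uniformProb fun ω : Coins n => LevelSucceeds c G t i ω.2 := by
        rw [uniformProb_snd]
        rw [uniformProb_not] at hprob
        linarith
      have hsucc (ω : Coins n) (h : LevelSucceeds c G t i ω.2) :=
        knownCoordinator_eval_of_succeeds c X ω hκ.le hn2 htn hmem h
      refine ⟨?_, i + 1, hi, ?_⟩
      · refine hgood.trans ((uniformProb_mono fun ω h => ?_).trans_eq
          (Protocol.prob_uniform _ _).symm)
        exact fun h0 => (hsucc ω h).1 ((knownFinder_out c t X ω).symm.trans h0)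
      · refine hgood.trans ((uniformProb_mono fun ω h => ?_).trans_eq
          (Protocol.prob_uniform _ _).symm)
        refine (congrArg Nat.cast (knownFinder_bits c t X ω)).trans_le ((hsucc ω h).2.trans ?_)
        simp only [bucketDegree]
        push_cast
        calc W * k * √(3 ^ i) * logFactor n = W * (k * √(3 ^ i) * logFactor n) := by ring
          _ ≤ K * commBound 4 n k √(3 ^ i) :=
            mul_le_mul (by linarith) (le_commBound k 4 hn) (by positivity) hK0.le
  · set G := inputGraph X with hGdef
    have hnd := mul_avgDegree G
    have hest : (k : ℝ) * (Nat.log 2 (n ^ 2) + 2) ≤ 4 * (k * logFactor n) := by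
      have := natLog_sq_le n
      have hk : (0 : ℝ) ≤ k := Nat.cast_nonneg k
      nlinarith
    refine ⟨?_, fun hd hfar => ?_⟩
    · have hm0 : (0 : ℝ) ≤ numEdges G := Nat.cast_nonneg _
      set s : ℝ := (n * avgDegree G) ^ (1 / 4 : ℝ) with hs
      have hms : √√(numEdges G : ℝ) ≤ s := sqrt_sqrt_le_rpow hm0 (by rw [hnd]; linarith)
      have hs0 : 0 ≤ s := (Real.sqrt_nonneg _).trans hms
      have hω (ω : Coins n) : ((unknownFinder c n k).bits X ω : ℝ) ≤
          4 * (k * logFactor n) + W * g * k * logFactor n * √√((2 : ℝ) ^ edgeLevel ω.1 G) := by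
        refine (unknownFinder_bits_le c X ω).trans (add_le_add hest ?_)
        refine (knownCoordinator_eval_snd_le c X ω hκ.le hγ hn2 (edgeLevel_le _ _)).trans_eq ?_
        ring
      have hexp : 𝔼 ω : Coins n, √√((2 : ℝ) ^ edgeLevel ω.1 G) ≤ 1 + 4 * s := by
        rw [expect_prod_type]
        simp only [Fintype.expect_const]
        exact (expect_sqrt_sqrt_le G).trans (by linarith)
      refine (Protocol.expectedBits_uniform _ X).trans_le ?_
      refine (Finset.expect_le_expect fun ω _ => hω ω).trans ?_
      rw [Finset.expect_add_distrib, Fintype.expect_const, ← Finset.mul_expect]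
      have h1 := mul_logFactor_le_commBound k hn hs0
      have h2 : k * s * logFactor n ≤ commBound 4 n k s := le_commBound k 4 hn
      have h3 := commBound_nonneg k 4 hn hs0
      calc 4 * (k * logFactor n) +
            W * g * k * logFactor n * 𝔼 ω : Coins n, √√((2 : ℝ) ^ edgeLevel ω.1 G)
          ≤ 4 * (k * logFactor n) + W * g * k * logFactor n * (1 + 4 * s) := by gcongr
        _ = (4 + W * g) * (k * logFactor n) + 4 * W * g * (k * s * logFactor n) := by ring
        _ ≤ (4 + W * g) * (K₀ * commBound 4 n k s) + 4 * W * g * commBound 4 n k s := by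
            gcongr
        _ = (K - (4 + W)) * commBound 4 n k s := by rw [hK]; ring
        _ ≤ K * commBound 4 n k s := by
            gcongr
            linarith
    · have hm := numEdges_pos_of_avgDegree_pos hd
      obtain ⟨i, hi, hrate⟩ := hrates n G hn2 hm hfar
      let Accurate (h : Sym2 (Fin n) → Fin (n ^ 2)) : Prop :=
        (numEdges G : ℝ) ≤ C * 2 ^ edgeLevel h G ∧ (2 : ℝ) ^ edgeLevel h G ≤ C * numEdges G
      let Good (ω : Coins n) : Prop :=
        Accurate ω.1 ∧ LevelSucceeds c G (edgeLevel ω.1 G) i ω.2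
      have hgood : 1 - δ ≤ uniformProb Good := by
        have h1 : uniformProb (fun ω : Coins n => ¬ Accurate ω.1) ≤ δ / 2 :=
          (uniformProb_fst fun h => ¬ Accurate h).trans_le
            ((uniformProb_bad_estimate_le G hm hC).trans hCδ)
        have h2 : uniformProb (fun ω : Coins n =>
            Accurate ω.1 ∧ ¬ LevelSucceeds c G (edgeLevel ω.1 G) i ω.2) ≤ δ / 2 := by
          refine uniformProb_prod_le fun h => ?_
          by_cases hh : Accurate h
          · exact (uniformProb_mono fun _ h' => h'.2).trans (hrate _ hh.1 hh.2).2
          · refine le_trans (le_of_eq ?_) (half_pos hδ).le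
            simp [uniformProb, hh]
        have h3 : uniformProb (fun ω : Coins n => ¬ Good ω) ≤ δ / 2 + δ / 2 := by
          refine (uniformProb_mono fun ω h => ?_).trans
            ((uniformProb_or_le _ _).trans (add_le_add h1 h2))
          by_cases hh : Accurate ω.1
          · exact Or.inr ⟨hh, fun h' => h ⟨hh, h'⟩⟩
          · exact Or.inl hh
        rw [uniformProb_not] at h3
        linarith
      have hsucc (ω : Coins n) (h : Good ω) :=
        knownCoordinator_eval_of_succeeds c X ω hκ.le hn2 (edgeLevel_le _ _)
          (hrate _ h.1.1 h.1.2).1 h.2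
      refine ⟨?_, i + 1, hi, ?_⟩
      · refine hgood.trans ((uniformProb_mono fun ω h => ?_).trans_eq
          (Protocol.prob_uniform _ _).symm)
        exact fun h0 => (hsucc ω h).1 ((unknownFinder_out c X ω).symm.trans h0)
      · refine hgood.trans ((uniformProb_mono fun ω h => ?_).trans_eq
          (Protocol.prob_uniform _ _).symm)
        refine (unknownFinder_bits_le c X ω).trans
          ((add_le_add hest (hsucc ω h).2).trans ?_)
        simp only [bucketDegree]
        push_cast
        have h1 := one_le_sqrt_pow i
        calc 4 * (k * logFactor n) + W * k * √(3 ^ i) * logFactor n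
            ≤ 4 * (k * logFactor n * √(3 ^ i)) + W * k * √(3 ^ i) * logFactor n := by
              have := le_mul_of_one_le_right (by positivity : 0 ≤ k * logFactor n) h1
              gcongr
          _ = (W + 4) * (k * √(3 ^ i) * logFactor n) := by ring
          _ ≤ K * commBound 4 n k √(3 ^ i) :=
            mul_le_mul hWK (le_commBound k 4 hn) (by positivity) hK0.le

/-! ### Testers from finders -/

section Tester

variable {n k : ℕ}

/-- The tester that accepts if a finder returns nothing. -/
def Finder.toTester (P : Finder n k) : Tester n k := P.map Option.isNone

theorem Finder.OneSided.toTester {P : Finder n k} (hP : P.OneSided) : P.toTester.OneSided := by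
  intro X ω hX
  refine (Protocol.out_map _ P X ω).trans ?_
  cases h : P.out X ω with
  | none => rfl
  | some t => exact absurd (hP X ω t h) (hX t)

theorem Finder.bits_toTester (P : Finder n k) (X : Fin k → SimpleGraph (Fin n)) (ω : P.Ω) :
    P.toTester.bits X ω = P.bits X ω :=
  Protocol.bits_map _ P X ω

theorem Finder.expectedBits_toTester (P : Finder n k) (X : Fin k → SimpleGraph (Fin n)) :
    P.toTester.expectedBits X = P.expectedBits X :=
  Finset.sum_congr rfl fun ω _ => by
    rw [P.bits_toTester X ω]
    rfl

theorem Finder.le_prob_toTester {P : Finder n k} {X : Fin k → SimpleGraph (Fin n)} {p : ℝ}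
    (h : p ≤ P.prob fun ω => P.out X ω ≠ none) :
    p ≤ P.toTester.prob fun ω => P.toTester.out X ω = false := by
  refine h.trans (P.prob_mono fun ω hω => ?_)
  refine (Protocol.out_map _ P X ω).trans ?_
  simpa [Option.isSome_iff_ne_none] using hω

theorem Finder.cheapByBucket_toTester {P : Finder n k} {X : Fin k → SimpleGraph (Fin n)}
    {ε δ K : ℝ} {a : ℕ} (h : CheapByBucket P X ε δ K a) :
    CheapByBucket P.toTester X ε δ K a := by
  obtain ⟨i, hi, hp⟩ := h
  refine ⟨i, hi, hp.trans (P.prob_mono fun ω hω => ?_)⟩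
  exact (congrArg Nat.cast (P.bits_toTester X ω)).trans_le hω

theorem Finder.OneSided.le_prob {P : Finder n k} (hP : P.OneSided)
    {X : Fin k → SimpleGraph (Fin n)} {p : ℝ} (h : p ≤ P.prob fun ω => P.out X ω ≠ none) :
    p ≤ P.prob fun ω => ∃ t, P.out X ω = some t ∧ (inputGraph X).IsNClique 3 t := by
  refine h.trans (P.prob_mono fun ω hω => ?_)
  obtain ⟨t, ht⟩ := Option.ne_none_iff_exists'.1 hω
  exact ⟨t, ht, hP X ω t ht⟩

theorem CheapByBucket.mono {P : Finder n k} {X : Fin k → SimpleGraph (Fin n)} {ε δ K : ℝ}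
    (hK : 0 ≤ K) (hn : 3 ≤ n) (h : CheapByBucket P X ε δ K 4) : CheapByBucket P X ε δ K 5 := by
  obtain ⟨i, hi, hp⟩ := h
  refine ⟨i, hi, hp.trans (P.prob_mono fun ω hω => hω.trans ?_)⟩
  exact mul_le_mul_of_nonneg_left (commBound_four_le_five k hn) hK

end Tester

end TriangleTesting

open CoordinatorModel TriangleTesting in
theorem mainTheorem2 (ε δ : ℝ) (hε : 0 < ε) (hε' : ε < 1) (hδ : 0 < δ) (hδ' : δ < 1) :
    ∃ C : ℝ, 0 < C ∧ ∀ n k : ℕ, 3 ≤ n →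
      -- finding a triangle, the average degree `d` being known
      (∀ d : ℝ, 0 < d → ∃ P : Finder n k, P.OneSided ∧
        ∀ X : Fin k → SimpleGraph (Fin n), avgDegree (inputGraph X) = d →
          (∀ ω, (P.bits X ω : ℝ) ≤ C * commBound 5 n k ((n * d) ^ (1 / 4 : ℝ))) ∧
          (IsFar TriangleFree ε (inputGraph X) →
            1 - δ ≤ P.prob (fun ω => ∃ t, P.out X ω = some t ∧ (inputGraph X).IsNClique 3 t) ∧
            CheapByBucket P X ε δ C 5)) ∧
      -- testing triangle-freeness, the average degree `d` being known
      (∀ d : ℝ, 0 < d → ∃ P : Tester n k, P.OneSided ∧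
        ∀ X : Fin k → SimpleGraph (Fin n), avgDegree (inputGraph X) = d →
          (∀ ω, (P.bits X ω : ℝ) ≤ C * commBound 4 n k ((n * d) ^ (1 / 4 : ℝ))) ∧
          (IsFar TriangleFree ε (inputGraph X) →
            1 - δ ≤ P.prob (fun ω => P.out X ω = false) ∧
            CheapByBucket P X ε δ C 4)) ∧
      -- finding a triangle, the average degree being unknown
      (∃ P : Finder n k, P.OneSided ∧
        ∀ X : Fin k → SimpleGraph (Fin n),
          P.expectedBits X ≤
            C * commBound 5 n k ((n * avgDegree (inputGraph X)) ^ (1 / 4 : ℝ)) ∧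
          (0 < avgDegree (inputGraph X) → IsFar TriangleFree ε (inputGraph X) →
            1 - δ ≤ P.prob (fun ω => ∃ t, P.out X ω = some t ∧ (inputGraph X).IsNClique 3 t) ∧
            CheapByBucket P X ε δ C 5)) ∧
      -- testing triangle-freeness, the average degree being unknown
      (∃ P : Tester n k, P.OneSided ∧
        ∀ X : Fin k → SimpleGraph (Fin n),
          P.expectedBits X ≤
            C * commBound 4 n k ((n * avgDegree (inputGraph X)) ^ (1 / 4 : ℝ)) ∧
          (0 < avgDegree (inputGraph X) → IsFar TriangleFree ε (inputGraph X) →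
            1 - δ ≤ P.prob (fun ω => P.out X ω = false) ∧
            CheapByBucket P X ε δ C 4)) := by
  obtain ⟨K, hK, h⟩ := exists_finders hε hδ
  refine ⟨K, hK, fun n k hn => ?_⟩
  obtain ⟨hknown, P, hP, hunknown⟩ := h n k hn
  have h45 (s : ℝ) : K * commBound 4 n k s ≤ K * commBound 5 n k s :=
    mul_le_mul_of_nonneg_left (commBound_four_le_five k hn) hK.le
  refine ⟨fun d hd => ?_, fun d hd => ?_, ⟨P, hP, fun X => ?_⟩, P.toTester, hP.toTester,
    fun X => ?_⟩
  · obtain ⟨Q, hQ, hX⟩ := hknown d hd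
    refine ⟨Q, hQ, fun X hd => ⟨fun ω => ((hX X hd).1 ω).trans (h45 _), fun hfar => ?_⟩⟩
    obtain ⟨h1, h2⟩ := (hX X hd).2 hfar
    exact ⟨hQ.le_prob h1, h2.mono hK.le hn⟩
  · obtain ⟨Q, hQ, hX⟩ := hknown d hd
    refine ⟨Q.toTester, hQ.toTester, fun X hd => ⟨fun ω => ?_, fun hfar => ?_⟩⟩
    · exact (congrArg Nat.cast (Q.bits_toTester X ω)).trans_le ((hX X hd).1 ω)
    · obtain ⟨h1, h2⟩ := (hX X hd).2 hfar
      exact ⟨Finder.le_prob_toTester h1, Finder.cheapByBucket_toTester h2⟩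
  · refine ⟨(hunknown X).1.trans (h45 _), fun hd hfar => ?_⟩
    obtain ⟨h1, h2⟩ := (hunknown X).2 hd hfar
    exact ⟨hP.le_prob h1, h2.mono hK.le hn⟩
  · refine ⟨(P.expectedBits_toTester X).trans_le (hunknown X).1, fun hd hfar => ?_⟩
    obtain ⟨h1, h2⟩ := (hunknown X).2 hd hfar
    exact ⟨Finder.le_prob_toTester h1, Finder.cheapByBucket_toTester h2⟩
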